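/- **Setting.** Let $T>0$, let $(\Omega,\mathcal F,\mathbb P)$ be a probability space with a filtration $\mathbb F=(\mathcal F_t)_{0\le t\le T}$ satisfying the usual conditions, and let $W$ be a one-dimensional $\mathbb F$-Brownian motion on $[0,T]$. Let $b\in\mathbb R$, $\sigma>0$. For $p>0$ and $t\in[0,T]$ the price started from $p$ at time $t$ is the geometric Brownian motion $P_s=p\exp\big((b-\tfrac{\sigma^2}{2})(s-t)+\sigma(W_s-W_t)\big)$, the solution of $dP=P(b\,dt+\sigma\,dW)$. Let $f:\mathbb R\times[0,T]\to[0,\infty]$ be Borel and such that - $f(0,\theta)=1$ and $f(\cdot,\theta)$ is nondecreasing for all $\theta\in[0,T]$; - $f(e,0)=0$ for $e<0$ and $f(e,0)=\infty$ for $e>0$; - $\sup_{e<0,\,\theta\in[0,T]}f(e,\theta)<1<\inf_{e>0,\,\theta\in[0,T]}f(e,\theta)$; - $f$ is continuous on $(\mathbb R\setminus\{0\})\times(0,T]$. Let $U:[0,\infty)\to\mathbb R$ be nondecreasing and concave with $U(0)=0$ and $0\le U(x)\le Kx^\gamma$ for all $x\geq 0$, for some $K\ge0$ and $\gamma\in[0,1)$.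 States are $(z,\theta)=(x,y,p,\theta)\in\mathbb R\times[0,\infty)\times(0,\infty)\times[0,T]$ (cash, number of shares, price, time since the last trade). Put $L(x,y,p,\theta)=x+yp\,f(-y,\theta)$ and let $\bar{\mathcal S}$ be the set of all states with $L(z,\theta)\ge0$. Fix $t\in[0,T]$ and $(z,\theta)=(x,y,p,\theta)\in\bar{\mathcal S}$. A strategy $\alpha=(\tau_n,\zeta_n)_{n\ge1}$ is a (finite or infinite) nondecreasing sequence of stopping times $\tau_n\le T$ with $\mathcal F_{\tau_n}$-measurable real $\zeta_n$ (the number of trades may depend on the scenario); put $\tau_0=t-\theta$. The controlled state process $(Z_s,\Theta_s)=(X_s,Y_s,P_s,\Theta_s)$, $t\le s\le T$, is $$X_s=x-\sum_{n\ge1,\,\tau_n\le s}\zeta_nP_{\tau_n}f(\zeta_n,\tau_n-\tau_{n-1}),\qquad Y_s=y+\sum_{n\ge1,\,\tau_n\le s}\zeta_n,\qquad \Theta_s=\inf\{s-\tau_n:n\ge0,\ \tau_n\le s\}.$$ The strategy is admissible if, almost surely, $\tau_n\ge t$ for all $n\ge1$ and the state stays in $\bar{\mathcal S}$ at all times of $[t,T]$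 and after each single trade (in particular, cash never becomes $-\infty$). Let $\mathcal A_\ell(t,z,\theta)$ be the set of admissible strategies with $Y_T=0$ a.s., let $N_T(\alpha)=\#\{n\ge1:\tau_n\le T\}$, and let $\mathcal A^b_\ell(t,z,\theta)$ be the set of $\alpha\in\mathcal A_\ell(t,z,\theta)$ such that a.s. $N_T(\alpha)<\infty$ and $\tau_0<\tau_1<\dots<\tau_{N_T(\alpha)}$. For $\varepsilon>0$ define, with values in $[-\infty,\infty]$ and $\sup\emptyset=-\infty$, $$v(t,z,\theta)=\sup_{\alpha\in\mathcal A_\ell(t,z,\theta)}\mathbb E[U(X_T)],\qquad \bar v_\varepsilon(t,z,\theta)=\sup_{\alpha\in\mathcal A^b_\ell(t,z,\theta)}\mathbb E\big[U(L(Z_T,\Theta_T))-\varepsilon N_T(\alpha)\big].$$ **Proposition.** (1) For every $(t,z,\theta)\in[0,T]\times\bar{\mathcal S}$, $\bar v_\varepsilon(t,z,\theta)$ is nondecreasing as $\varepsilon$ decreases to $0$: if $0<\varepsilon_1\le\varepsilon_2$, then $\bar v_{\varepsilon_2}(t,z,\theta)\le\bar v_{\varepsilon_1}(t,z,\theta)$.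 (2) For every $(t,z,\theta)\in[0,T)\times\bar{\mathcal S}$, $\bar v_\varepsilon(t,z,\theta)\to v(t,z,\theta)$ as $\varepsilon\downarrow0$. The same holds at $t=T$ for every $(z,\theta)=(x,y,p,\theta)\in\bar{\mathcal S}$ such that $y=0$ or $\theta>0$, and such that $L(x,r,p,\theta)\le L(x,y,p,\theta)$ for all $r\in[0,y]$ (the latter holds in particular if $e\mapsto e f(e,\theta)$ is nondecreasing). -/

import Mathlib

open Set Filter Topology MeasureTheory ProbabilityTheory
open scoped NNReal ENNReal

namespace IlliquidMarket

/-- `W` is a Brownian motion on `[0, T]` relative to the filtration `𝓕`. -/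
structure IsBrownianMotion {Ω : Type*} {mΩ : MeasurableSpace Ω} {T : ℝ}
    (𝓕 : Filtration (Icc (0 : ℝ) T) mΩ) (W : Icc (0 : ℝ) T → Ω → ℝ) (μ : Measure Ω) : Prop where
  adapted : ∀ t, Measurable[𝓕 t] (W t)
  zero : ∀ t : Icc (0 : ℝ) T, (t : ℝ) = 0 → ∀ᵐ ω ∂μ, W t ω = 0
  law_increment : ∀ s t : Icc (0 : ℝ) T, s ≤ t →
    HasLaw (fun ω => W t ω - W s ω) (gaussianReal 0 (Real.toNNReal ((t : ℝ) - (s : ℝ)))) μ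
  indep_increment : ∀ s t : Icc (0 : ℝ) T, s ≤ t →
    Indep (MeasurableSpace.comap (fun ω => W t ω - W s ω) inferInstance) (𝓕 s) μ
  continuous_paths : ∀ᵐ ω ∂μ, Continuous fun t => W t ω

/-- The usual conditions: right-continuity, and every null set belongs to every `𝓕 t`. -/
structure UsualConditions {Ω : Type*} {mΩ : MeasurableSpace Ω} {T : ℝ}
    (𝓕 : Filtration (Icc (0 : ℝ) T) mΩ) (μ : Measure Ω) : Prop where
  rightContinuous : 𝓕.IsRightContinuous
  complete : ∀ A : Set Ω, μ A = 0 → ∀ t, MeasurableSet[𝓕 t] A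

/-- The data of the market: horizon, filtration, driving noise, drift, volatility, temporary price
impact function and utility function. Only the values of `f` on `ℝ × [0, T]` and the values of `U`
on `[0, ∞)` matter. -/
structure Market (Ω : Type*) [mΩ : MeasurableSpace Ω] where
  T : ℝ
  T_pos : 0 < T
  𝓕 : Filtration (Icc (0 : ℝ) T) mΩ
  W : Icc (0 : ℝ) T → Ω → ℝ
  b : ℝ
  σ : ℝ
  f : ℝ → ℝ → ℝ≥0∞
  U : ℝ → ℝ

/-- A state `(z, θ) = (x, y, p, θ)`: cash, number of shares, market price, time since the last
trade. -/
@[ext]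
structure State where
  x : ℝ
  y : ℝ
  p : ℝ
  θ : ℝ

/-- The extended expectation `E[ξ⁺] - E[ξ⁻]` of an extended-real random variable. It is `-∞` when
`E[ξ⁺]` is finite and `E[ξ⁻]` is infinite. -/
noncomputable def expectation {Ω : Type*} [MeasurableSpace Ω] (μ : Measure Ω) (ξ : Ω → EReal) :
    EReal :=
  ((∫⁻ ω, (ξ ω).toENNReal ∂μ : ℝ≥0∞) : EReal) - ((∫⁻ ω, (-ξ ω).toENNReal ∂μ : ℝ≥0∞) : EReal)

namespace Market

variable {Ω : Type*} [mΩ : MeasurableSpace Ω]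

/-! ### Assumptions on the price impact function and on the utility function -/

/-- `f` is Borel, `f(0, θ) = 1` and `f(·, θ)` is nondecreasing. -/
structure ImpactMonotone (M : Market Ω) : Prop where
  measurable : Measurable fun q : ℝ × ℝ => M.f q.1 q.2
  zero : ∀ θ ∈ Icc 0 M.T, M.f 0 θ = 1
  mono : ∀ θ ∈ Icc 0 M.T, Monotone fun e => M.f e θ

/-- An immediate sale brings nothing, an immediate purchase is infinitely expensive. -/
structure ImpactImmediate (M : Market Ω) : Prop where
  sale : ∀ e < 0, M.f e 0 = 0
  purchase : ∀ e > 0, M.f e 0 = ∞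

/-- Bid-ask spread: `sup f < 1` over sales and `inf f > 1` over purchases. -/
structure ImpactSpread (M : Market Ω) : Prop where
  bid : (⨆ e ∈ Iio (0 : ℝ), ⨆ θ ∈ Icc 0 M.T, M.f e θ) < 1
  ask : 1 < ⨅ e ∈ Ioi (0 : ℝ), ⨅ θ ∈ Icc 0 M.T, M.f e θ

/-- `f` is continuous, as a map into `[0, ∞]`, on `ℝ* × (0, T]`. -/
def ImpactContinuous (M : Market Ω) : Prop :=
  ContinuousOn (fun q : ℝ × ℝ => M.f q.1 q.2) {q | q.1 ≠ 0 ∧ q.2 ∈ Ioc 0 M.T}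

/-- `U` is nondecreasing and concave on `[0, ∞)`, `U(0) = 0` and `0 ≤ U(x) ≤ K x ^ γ`. -/
structure UtilityCondition (M : Market Ω) : Prop where
  mono : MonotoneOn M.U (Ici 0)
  concave : ConcaveOn ℝ (Ici 0) M.U
  zero : M.U 0 = 0
  growth : ∃ K γ : ℝ, 0 ≤ K ∧ 0 ≤ γ ∧ γ < 1 ∧ ∀ x, 0 ≤ x → 0 ≤ M.U x ∧ M.U x ≤ K * x ^ γ

/-! ### Liquidation value and solvency region -/

/-- The liquidation value `L(x, y, p, θ) = x + y p f(-y, θ)` (the factor `f(-y, θ)` is at most `1`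
for `y ≥ 0`). -/
noncomputable def L (M : Market Ω) (q : State) : ℝ :=
  q.x + q.y * q.p * (M.f (-q.y) q.θ).toReal

/-- The set `ℝ × ℝ₊ × ℝ₊* × [0, T]` of all states. -/
def stateSpace (M : Market Ω) : Set State := {q | 0 ≤ q.y ∧ 0 < q.p ∧ q.θ ∈ Icc 0 M.T}

/-- The solvency region `S`. -/
def solvency (M : Market Ω) : Set State := {q ∈ M.stateSpace | 0 < q.y ∧ 0 < M.L q}

/-- The part `y = 0` of the boundary. -/
def boundaryY (M : Market Ω) : Set State := {q ∈ M.stateSpace | q.y = 0 ∧ 0 ≤ M.L q}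

/-- The part `L = 0` of the boundary. -/
def boundaryL (M : Market Ω) : Set State := {q ∈ M.stateSpace | M.L q = 0}

/-- The closed solvency region `S̄ = S ∪ ∂S`. -/
def closedSolvency (M : Market Ω) : Set State := M.solvency ∪ (M.boundaryY ∪ M.boundaryL)

theorem mem_closedSolvency_iff (M : Market Ω) (q : State) :
    q ∈ M.closedSolvency ↔ q ∈ M.stateSpace ∧ 0 ≤ M.L q := by
  simp only [closedSolvency, solvency, boundaryY, boundaryL, mem_union, mem_ofPred_eq]
  constructor
  · rintro (⟨h, -, h'⟩ | ⟨h, -, h'⟩ | ⟨h, h'⟩)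
    · exact ⟨h, h'.le⟩
    · exact ⟨h, h'⟩
    · exact ⟨h, h'.ge⟩
  · rintro ⟨h, h'⟩
    rcases h'.eq_or_lt with h0 | h0
    · exact Or.inr (Or.inr ⟨h, h0.symm⟩)
    · rcases h.1.eq_or_lt with hy | hy
      · exact Or.inr (Or.inl ⟨h, hy.symm, h'⟩)
      · exact Or.inl ⟨h, hy, h0⟩

/-! ### Price and trading strategies -/

/-- The price at time `s` started from `p` at time `t`: the geometric Brownian motion solving
`dP = P (b dt + σ dW)`. -/
noncomputable def price (M : Market Ω) (t : Icc (0 : ℝ) M.T) (p : ℝ) (s : Icc (0 : ℝ) M.T)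
    (ω : Ω) : ℝ :=
  p * Real.exp ((M.b - M.σ ^ 2 / 2) * ((s : ℝ) - (t : ℝ)) + M.σ * (M.W s ω - M.W t ω))

/-- The final time, as a point of `[0, T]`. -/
def terminal (M : Market Ω) : Icc (0 : ℝ) M.T := ⟨M.T, M.T_pos.le, le_rfl⟩

/-- An impulse control `(τₙ, ζₙ)` for `n ≥ 1`; the index `n : ℕ` stands for the trade number
`n + 1`. The value `τ n ω = ⊤` means that in the scenario `ω` there is no such trade, so that a
strategy may have finitely or infinitely many trades. A positive `ζ` is a purchase, a negative `ζ`
is a sale. Trading times need not be strictly increasing. -/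
structure Strategy (M : Market Ω) where
  τ : ℕ → Ω → WithTop (Icc (0 : ℝ) M.T)
  ζ : ℕ → Ω → ℝ
  isStoppingTime : ∀ n, IsStoppingTime M.𝓕 (τ n)
  mono : ∀ ω, Monotone fun n => τ n ω
  measurable_ζ : ∀ n, Measurable[(isStoppingTime n).measurableSpace] (ζ n)

namespace Strategy

variable {M : Market Ω}

/-- The trading time as a real number (only used where the trade takes place). -/
noncomputable def time (α : M.Strategy) (n : ℕ) (ω : Ω) : ℝ :=
  WithTop.recTopCoe (C := fun _ => ℝ) 0 (fun s : Icc (0 : ℝ) M.T => (s : ℝ)) (α.τ n ω)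

/-- The time elapsed between a trade and the preceding one. The trade preceding the first one took
place at time `τ₀ = t - θ`. -/
noncomputable def lag (α : M.Strategy) (t : Icc (0 : ℝ) M.T) (q : State) : ℕ → Ω → ℝ
  | 0, ω => α.time 0 ω - ((t : ℝ) - q.θ)
  | n + 1, ω => α.time (n + 1) ω - α.time n ω

/-- The market price at a trading time (only used where the trade takes place). -/
noncomputable def tradePrice (α : M.Strategy) (t : Icc (0 : ℝ) M.T) (q : State) (n : ℕ) (ω : Ω) :
    ℝ :=
  WithTop.recTopCoe (C := fun _ => ℝ) 0 (fun s => M.price t q.p s ω) (α.τ n ω)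

/-- The amount `ζₙ P_{τₙ} f(ζₙ, τₙ - τₙ₋₁)` paid at a trade (negative for a sale). -/
noncomputable def cost (α : M.Strategy) (t : Icc (0 : ℝ) M.T) (q : State) (n : ℕ) (ω : Ω) : ℝ :=
  α.ζ n ω * α.tradePrice t q n ω * (M.f (α.ζ n ω) (α.lag t q n ω)).toReal

/-- The state immediately after the trade of index `n`; when several trades take place at the same
time, the later ones are not yet taken into account. -/
noncomputable def stateAfter (α : M.Strategy) (t : Icc (0 : ℝ) M.T) (q : State) (n : ℕ) (ω : Ω) :
    State where
  x := q.x - ∑ k ∈ Finset.range (n + 1), α.cost t q k ω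
  y := q.y + ∑ k ∈ Finset.range (n + 1), α.ζ k ω
  p := α.tradePrice t q n ω
  θ := 0

open scoped Classical in
/-- The controlled state process `(X_s, Y_s, P_s, Θ_s)` started from `q` just before time `t`:
cash and shares are constant except for the jumps at the trading times, and `Θ_s` is the
infimum of `s - τₙ` over all `n ≥ 0` with `τₙ ≤ s`, where `τ₀ = t - θ`. -/
noncomputable def state (α : M.Strategy) (t : Icc (0 : ℝ) M.T) (q : State)
    (s : Icc (0 : ℝ) M.T) (ω : Ω) : State where
  x := q.x - ∑' n, if α.τ n ω ≤ (s : WithTop (Icc (0 : ℝ) M.T)) then α.cost t q n ω else 0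
  y := q.y + ∑' n, if α.τ n ω ≤ (s : WithTop (Icc (0 : ℝ) M.T)) then α.ζ n ω else 0
  p := M.price t q.p s ω
  θ := sInf (insert ((s : ℝ) - ((t : ℝ) - q.θ))
    {r | ∃ n, α.τ n ω ≤ (s : WithTop (Icc (0 : ℝ) M.T)) ∧ r = (s : ℝ) - α.time n ω})

open scoped Classical in
/-- The number `N_T(α)` of trades up to the final time. -/
noncomputable def numTrades (α : M.Strategy) (ω : Ω) : ℝ≥0∞ :=
  ∑' n, if α.τ n ω ≤ (M.terminal : WithTop (Icc (0 : ℝ) M.T)) then 1 else 0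

/-- `α ∈ A(t, z, θ)`: almost surely no trade takes place before `t`, no trade is made at an infinite
price (this would make the cash `-∞`), and the state stays in the closed solvency region, after
each single trade and at all times of `[t, T]`. -/
def Admissible (α : M.Strategy) (μ : Measure Ω) (t : Icc (0 : ℝ) M.T) (q : State) : Prop :=
  ∀ᵐ ω ∂μ,
    (∀ n, (t : WithTop (Icc (0 : ℝ) M.T)) ≤ α.τ n ω) ∧
    (∀ n, α.τ n ω ≠ ⊤ →
      M.f (α.ζ n ω) (α.lag t q n ω) ≠ ∞ ∧ α.stateAfter t q n ω ∈ M.closedSolvency) ∧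
    (∀ s, t ≤ s → α.state t q s ω ∈ M.closedSolvency)

/-- `α ∈ A_ℓ(t, z, θ)`: admissible, and no shares are left at the final time. -/
def Liquidating (α : M.Strategy) (μ : Measure Ω) (t : Icc (0 : ℝ) M.T) (q : State) : Prop :=
  α.Admissible μ t q ∧ ∀ᵐ ω ∂μ, (α.state t q M.terminal ω).y = 0

/-- `α ∈ A_ℓᵇ(t, z, θ)`: moreover, almost surely there are finitely many trades and
`τ₀ < τ₁ < τ₂ < ⋯` for those that take place, with `τ₀ = t - θ`. -/
def FiniteLiquidating (α : M.Strategy) (μ : Measure Ω) (t : Icc (0 : ℝ) M.T) (q : State) : Prop :=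
  α.Liquidating μ t q ∧
    ∀ᵐ ω ∂μ, α.numTrades ω < ∞ ∧ ∀ n, α.τ n ω ≠ ⊤ → 0 < α.lag t q n ω

end Strategy

/-! ### Value functions -/

/-- The value function `v` of the optimal portfolio liquidation problem. -/
noncomputable def value (M : Market Ω) (μ : Measure Ω) (t : Icc (0 : ℝ) M.T) (q : State) : EReal :=
  ⨆ (α : M.Strategy) (_ : α.Liquidating μ t q),
    expectation μ fun ω => ((M.U (α.state t q M.terminal ω).x : ℝ) : EReal)

/-- The value function of the problem penalized by a utility cost `ε` per trade. -/
noncomputable def penalizedValue (M : Market Ω) (μ : Measure Ω) (ε : ℝ) (t : Icc (0 : ℝ) M.T)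
    (q : State) : EReal :=
  ⨆ (α : M.Strategy) (_ : α.FiniteLiquidating μ t q),
    expectation μ fun ω =>
      ((M.U (M.L (α.state t q M.terminal ω)) : ℝ) : EReal) -
        (ε : EReal) * ((α.numTrades ω : ℝ≥0∞) : EReal)

end Market

end IlliquidMarket

/-! ### Pathwise solvency and feasibility -/

namespace IlliquidMarket
namespace Market

variable {Ω : Type*} [mΩ : MeasurableSpace Ω] {M : Market Ω}

/-! Monotonicity in `ε` and the bound by `M.value` are immediate: a liquidating strategy ends
without shares, so its final liquidation value is its cash, and the penalty only lowers the
objective. The substance is the converse: if `a` lies below the expected utility of some liquidating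
`α`, then some strategy with strictly increasing times and a bounded number of trades still beats
`a` (`exists_finiteLiquidating`). With at most `N` trades the penalty is at most `ε * N`, so a small
`ε` suffices (`exists_lt_expectation_sub`).

Just after a trade the shares are worth nothing, so solvency there means nonnegative cash and
shares. A second trade at the same instant can only be a sale for nothing
(`cost_eq_zero_of_lag_eq_zero`) and can be postponed. When `t < T`, keep the first `m` trades of
`α`, stop at a time `u m < T`, make one sale at `u m` unless a trade has just taken place there, and
sell the rest at `T` (`cut`). The sale at `u m` has two roles: if nothing has been traded yet it can
turn a negative cash into the nonnegative liquidation value (`cut_cash_first_nonneg`), and it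
imitates the one sale with positive lag that `α` may make at `T` (`exists_le_cutCash_of_late`). The
size of that future sale is unknown at `u m`, so the strategy takes the best sale on a finite grid,
which is measurable and asymptotically no worse.

As `u m` tends to `T`, the final cash is bounded below by a sequence converging to that of `α`.
Infinitely many trades are handled by the bid-ask spread, which makes the cash flows summable
(`summable_cost_of_spread`). Lower semicontinuity of `U` and Fatou's lemma pass to expectations.
Removing the empty trades (`compress`) makes the times strictly increasing.

At `t = T` only the first trade can bring cash, and the condition on `L` says that selling
everything at once is optimal (`terminal_cash_le`). -/

theorem price_pos {t s : Icc (0 : ℝ) M.T} {p : ℝ} (hp : 0 < p) (ω : Ω) : 0 < M.price t p s ω :=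
  mul_pos hp (Real.exp_pos _)

theorem mem_closedSolvency_of_cash_nonneg {q : State} (hq : q ∈ M.stateSpace) (hx : 0 ≤ q.x) :
    q ∈ M.closedSolvency := by
  rw [mem_closedSolvency_iff]
  exact ⟨hq, add_nonneg hx (mul_nonneg (mul_nonneg hq.1 hq.2.1.le) ENNReal.toReal_nonneg)⟩

/-- An immediate further sale would bring nothing. Hence, right after a trade, solvency is a
condition on cash alone once the shares are nonnegative. -/
theorem L_eq_cash_of_zero_lag (hf : M.ImpactImmediate) {q : State} (hθ : q.θ = 0) (hy : 0 ≤ q.y) :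
    M.L q = q.x := by
  rcases hy.eq_or_lt with h | h
  · simp [L, ← h]
  · simp [L, hθ, hf.sale (-q.y) (by linarith)]

theorem L_eq_cash_of_no_shares {q : State} (hy : q.y = 0) : M.L q = q.x := by
  simp [L, hy]

theorem impact_le_one (hf : M.ImpactMonotone) {e θ : ℝ} (he : e ≤ 0) (hθ : θ ∈ Icc 0 M.T) :
    M.f e θ ≤ 1 :=
  (hf.mono θ hθ he).trans_eq (hf.zero θ hθ)

theorem impact_ne_top (hf : M.ImpactMonotone) {e θ : ℝ} (he : e ≤ 0) (hθ : θ ∈ Icc 0 M.T) :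
    M.f e θ ≠ ∞ :=
  ((impact_le_one hf he hθ).trans_lt ENNReal.one_lt_top).ne

namespace Strategy

variable {α : M.Strategy} {t : Icc (0 : ℝ) M.T} {q : State} {ω : Ω}

/-- The time of the preceding trade. -/
noncomputable def prevTime (α : M.Strategy) (t : Icc (0 : ℝ) M.T) (q : State) : ℕ → Ω → ℝ
  | 0, _ => (t : ℝ) - q.θ
  | n + 1, ω => α.time n ω

theorem lag_eq (α : M.Strategy) (t : Icc (0 : ℝ) M.T) (q : State) (n : ℕ) (ω : Ω) :
    α.lag t q n ω = α.time n ω - α.prevTime t q n ω := by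
  cases n <;> rfl

theorem time_of_eq {n : ℕ} {s : Icc (0 : ℝ) M.T} (h : α.τ n ω = s) : α.time n ω = s := by
  simp [time, h]

theorem tradePrice_of_eq {n : ℕ} {s : Icc (0 : ℝ) M.T} (h : α.τ n ω = s) :
    α.tradePrice t q n ω = M.price t q.p s ω := by
  simp [tradePrice, h]

theorem time_mem (α : M.Strategy) (n : ℕ) (ω : Ω) : α.time n ω ∈ Icc 0 M.T := by
  rcases eq_or_ne (α.τ n ω) ⊤ with h | h
  · simp [time, h, M.T_pos.le]
  · obtain ⟨s, hs⟩ := WithTop.ne_top_iff_exists.1 h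
    rw [time_of_eq hs.symm]
    exact s.2

theorem tau_ne_top_of_le {i n : ℕ} (h : i ≤ n) (hn : α.τ n ω ≠ ⊤) : α.τ i ω ≠ ⊤ :=
  ne_top_of_le_ne_top hn (α.mono ω h)

theorem tau_eq_top_of_le {i n : ℕ} (h : i ≤ n) (hi : α.τ i ω = ⊤) : α.τ n ω = ⊤ :=
  top_le_iff.1 (hi ▸ α.mono ω h)

theorem tau_le_iff {n : ℕ} {s : Icc (0 : ℝ) M.T} :
    α.τ n ω ≤ s ↔ α.τ n ω ≠ ⊤ ∧ α.time n ω ≤ s := by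
  rcases eq_or_ne (α.τ n ω) ⊤ with h | h
  · simp [h]
  · obtain ⟨r, hr⟩ := WithTop.ne_top_iff_exists.1 h
    rw [time_of_eq hr.symm, ← hr]
    simp

theorem le_time {n : ℕ} {s : Icc (0 : ℝ) M.T} (hn : α.τ n ω ≠ ⊤) (h : s ≤ α.τ n ω) :
    s ≤ α.time n ω := by
  obtain ⟨r, hr⟩ := WithTop.ne_top_iff_exists.1 hn
  rw [time_of_eq hr.symm]
  rw [← hr] at h
  exact_mod_cast h

theorem time_mono {i n : ℕ} (h : i ≤ n) (hn : α.τ n ω ≠ ⊤) : α.time i ω ≤ α.time n ω := by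
  obtain ⟨r, hr⟩ := WithTop.ne_top_iff_exists.1 hn
  rw [time_of_eq hr.symm]
  exact (tau_le_iff.1 (hr ▸ α.mono ω h)).2

theorem tau_le_terminal_iff {n : ℕ} : α.τ n ω ≤ M.terminal ↔ α.τ n ω ≠ ⊤ := by
  rw [tau_le_iff]
  exact ⟨fun h => h.1, fun h => ⟨h, (α.time_mem n ω).2⟩⟩

theorem tradePrice_pos (hp : 0 < q.p) {n : ℕ} (hn : α.τ n ω ≠ ⊤) : 0 < α.tradePrice t q n ω := by
  obtain ⟨r, hr⟩ := WithTop.ne_top_iff_exists.1 hn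
  rw [tradePrice_of_eq hr.symm]
  exact price_pos hp ω

/-- The pathwise conditions of admissibility that only concern the trades and the time before the
first of them. -/
def Feasible (α : M.Strategy) (t : Icc (0 : ℝ) M.T) (q : State) (ω : Ω) : Prop :=
  (∀ n, (t : WithTop (Icc (0 : ℝ) M.T)) ≤ α.τ n ω) ∧
  (∀ n, α.τ n ω ≠ ⊤ →
    M.f (α.ζ n ω) (α.lag t q n ω) ≠ ∞ ∧ α.stateAfter t q n ω ∈ M.closedSolvency) ∧
  ∀ s, t ≤ s → (s : WithTop (Icc (0 : ℝ) M.T)) < α.τ 0 ω →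
    (⟨q.x, q.y, M.price t q.p s ω, (s : ℝ) - ((t : ℝ) - q.θ)⟩ : State) ∈ M.closedSolvency

theorem state_of_lt {s : Icc (0 : ℝ) M.T} (h : s < α.τ 0 ω) :
    α.state t q s ω = ⟨q.x, q.y, M.price t q.p s ω, (s : ℝ) - ((t : ℝ) - q.θ)⟩ := by
  have h' : ∀ n, ¬ α.τ n ω ≤ s := fun n => not_le.2 (h.trans_le (α.mono ω (Nat.zero_le n)))
  simp [state, h']

theorem Feasible.lag_nonneg (h : α.Feasible t q ω) (hθ : 0 ≤ q.θ) {n : ℕ} (hn : α.τ n ω ≠ ⊤) :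
    0 ≤ α.lag t q n ω := by
  cases n with
  | zero =>
    have := le_time hn (h.1 0)
    simp only [lag]
    linarith
  | succ n =>
    have := time_mono (Nat.le_succ n) hn
    simp only [lag]
    linarith

theorem Feasible.shares_nonneg (h : α.Feasible t q ω) {n : ℕ} (hn : α.τ n ω ≠ ⊤) :
    0 ≤ q.y + ∑ k ∈ Finset.range (n + 1), α.ζ k ω :=
  ((mem_closedSolvency_iff _ _).1 (h.2.1 n hn).2).1.1

theorem Feasible.cash_nonneg (hf : M.ImpactImmediate) (h : α.Feasible t q ω) {n : ℕ}
    (hn : α.τ n ω ≠ ⊤) : 0 ≤ q.x - ∑ k ∈ Finset.range (n + 1), α.cost t q k ω := by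
  have := ((mem_closedSolvency_iff _ _).1 (h.2.1 n hn).2).2
  rwa [L_eq_cash_of_zero_lag hf rfl (h.shares_nonneg hn)] at this

theorem stateAfter_mem (hp : 0 < q.p) {n : ℕ} (hn : α.τ n ω ≠ ⊤)
    (hx : 0 ≤ q.x - ∑ k ∈ Finset.range (n + 1), α.cost t q k ω)
    (hy : 0 ≤ q.y + ∑ k ∈ Finset.range (n + 1), α.ζ k ω) :
    α.stateAfter t q n ω ∈ M.closedSolvency :=
  mem_closedSolvency_of_cash_nonneg
    ⟨hy, tradePrice_pos hp hn, left_mem_Icc.2 M.T_pos.le⟩ hx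

open scoped Classical in
theorem tsum_trades_eq {g : ℕ → ℝ} {n : ℕ} {s : Icc (0 : ℝ) M.T} (h : α.τ n ω ≤ s)
    (h' : s < α.τ (n + 1) ω) :
    (∑' k, if α.τ k ω ≤ (s : WithTop (Icc (0 : ℝ) M.T)) then g k else 0) =
      ∑ k ∈ Finset.range (n + 1), g k := by
  rw [tsum_eq_sum (s := Finset.range (n + 1))]
  · refine Finset.sum_congr rfl fun k hk => if_pos ((α.mono ω ?_).trans h)
    exact Nat.lt_succ_iff.1 (Finset.mem_range.1 hk)
  · intro k hk
    refine if_neg (not_le.2 (h'.trans_le (α.mono ω ?_)))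
    simpa using hk

/-- Between trades cash and shares keep the nonnegative values they had after the last trade, and
nonnegative cash gives solvency whatever the price and the lag. Only the period before the first
trade needs a clause of its own. -/
theorem Feasible.state_mem (hf : M.ImpactImmediate) (hp : 0 < q.p) (hθ : 0 ≤ q.θ)
    (h : α.Feasible t q ω) {N : ℕ} (hN : α.τ N ω = ⊤) {s : Icc (0 : ℝ) M.T} (hs : t ≤ s) :
    α.state t q s ω ∈ M.closedSolvency := by
  classical
  rcases lt_or_ge (s : WithTop (Icc (0 : ℝ) M.T)) (α.τ 0 ω) with h0 | h0
  · rw [state_of_lt h0]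
    exact h.2.2 s hs h0
  have hex : ∃ n, (s : WithTop (Icc (0 : ℝ) M.T)) < α.τ n ω := ⟨N, by simp [hN]⟩
  -- The predecessor of the first trade after `s` is the last trade made by time `s`.
  obtain ⟨n, hn⟩ : ∃ n, Nat.find hex = n + 1 :=
    Nat.exists_eq_succ_of_ne_zero fun h1 => not_lt.2 h0 (h1 ▸ Nat.find_spec hex)
  have hlt : s < α.τ (n + 1) ω := hn ▸ Nat.find_spec hex
  have hle : α.τ n ω ≤ s := not_lt.1 (Nat.find_min hex (by omega))
  have hn0 : α.τ n ω ≠ ⊤ := (tau_le_iff.1 hle).1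
  refine mem_closedSolvency_of_cash_nonneg ⟨?_, price_pos hp ω, ?_⟩ ?_
  · simp only [state, tsum_trades_eq hle hlt]
    exact h.shares_nonneg hn0
  · have hst : (t : ℝ) ≤ s := hs
    have hnn : ∀ r ∈ insert ((s : ℝ) - ((t : ℝ) - q.θ))
        {r | ∃ n, α.τ n ω ≤ (s : WithTop (Icc (0 : ℝ) M.T)) ∧ r = (s : ℝ) - α.time n ω},
        0 ≤ r := by
      rintro r (rfl | ⟨k, hk, rfl⟩)
      · linarith
      · linarith [(tau_le_iff.1 hk).2]
    refine ⟨le_csInf ⟨_, mem_insert _ _⟩ hnn, ?_⟩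
    refine (csInf_le ⟨0, fun r hr => hnn r hr⟩ (mem_insert_of_mem _ ⟨n, hle, rfl⟩)).trans ?_
    have := (α.time_mem n ω).1
    linarith [s.2.2]
  · simp only [state, tsum_trades_eq hle hlt]
    exact h.cash_nonneg hf hn0

theorem Admissible.feasible {μ : Measure Ω} (h : α.Admissible μ t q) :
    ∀ᵐ ω ∂μ, α.Feasible t q ω := by
  filter_upwards [h] with ω ⟨h1, h2, h3⟩
  exact ⟨h1, h2, fun s hs hlt => state_of_lt hlt ▸ h3 s hs⟩

theorem admissible_of_feasible (hf : M.ImpactImmediate) (hp : 0 < q.p) (hθ : 0 ≤ q.θ) {N : ℕ}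
    (hN : ∀ ω, α.τ N ω = ⊤) {μ : Measure Ω} (h : ∀ᵐ ω ∂μ, α.Feasible t q ω) :
    α.Admissible μ t q := by
  filter_upwards [h] with ω hω
  exact ⟨hω.1, hω.2.1, fun s hs => hω.state_mem hf hp hθ (hN ω) hs⟩

/-- A purchase at zero lag would have an infinite price and a sale is paid nothing. This is what
allows simultaneous trades to be dropped. -/
theorem cost_eq_zero_of_lag_eq_zero (hf : M.ImpactImmediate) {n : ℕ}
    (hfin : M.f (α.ζ n ω) (α.lag t q n ω) ≠ ∞) (h : α.lag t q n ω = 0) :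
    α.ζ n ω ≤ 0 ∧ α.cost t q n ω = 0 := by
  rw [h] at hfin
  rcases lt_trichotomy (α.ζ n ω) 0 with h0 | h0 | h0
  · exact ⟨h0.le, by simp [cost, h, hf.sale _ h0]⟩
  · exact ⟨h0.le, by simp [cost, h0]⟩
  · exact absurd (hf.purchase _ h0) hfin

open scoped Classical in
theorem tsum_terminal_eq {N : ℕ} (hN : α.τ N ω = ⊤) (g : ℕ → ℝ) :
    (∑' k, if α.τ k ω ≤ (M.terminal : WithTop (Icc (0 : ℝ) M.T)) then g k else 0) =
      ∑ k ∈ Finset.range N, if α.τ k ω ≠ ⊤ then g k else 0 := by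
  simp only [tau_le_terminal_iff]
  refine tsum_eq_sum fun k hk => if_neg (not_not.2 (tau_eq_top_of_le ?_ hN))
  simpa using hk

theorem numTrades_le {N : ℕ} (hN : α.τ N ω = ⊤) : α.numTrades ω ≤ N := by
  classical
  rw [numTrades, tsum_eq_sum (s := Finset.range N)]
  · calc _ ≤ ∑ k ∈ Finset.range N, (1 : ℝ≥0∞) :=
        Finset.sum_le_sum fun k _ => by split_ifs <;> simp
      _ = N := by simp
  · intro k hk
    refine if_neg fun h => tau_le_terminal_iff.1 h (tau_eq_top_of_le ?_ hN)
    simpa using hk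

end Strategy

end Market
end IlliquidMarket

/-! ### Removing trades simultaneous with their predecessor -/

namespace IlliquidMarket

section Counting

open scoped Classical in
theorem nth_mem_of_lt_count {p : ℕ → Prop} {k N : ℕ} (h : k < Nat.count p N) :
    p (Nat.nth p k) ∧ Nat.nth p k < N ∧ Nat.count p (Nat.nth p k) = k := by
  -- `Nat.nth` takes the default value `0` beyond the last element of a finite set; the bound by
  -- `Nat.count` excludes this.
  have h' : ∀ hf : (Set.ofPred p).Finite, k < hf.toFinset.card := by
    intro hf
    refine h.trans_le ?_
    rw [Nat.count_eq_card_filter_range]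
    refine Finset.card_le_card fun i hi => ?_
    simpa using (Finset.mem_filter.1 hi).2
  exact ⟨Nat.nth_mem k h', Nat.nth_lt_of_lt_count h, Nat.count_nth h'⟩

open scoped Classical in
theorem sum_nth {p : ℕ → Prop} {β : Type*} [AddCommMonoid β] (g : ℕ → β) (n : ℕ) :
    ∑ k ∈ Finset.range (Nat.count p n), g (Nat.nth p k) =
      ∑ j ∈ Finset.range n, if p j then g j else 0 := by
  induction n with
  | zero => simp
  | succ n ih =>
    rw [Finset.sum_range_succ, ← ih, Nat.count_succ]
    split_ifs with h
    · rw [Finset.sum_range_succ, Nat.nth_count h]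
    · simp

end Counting

namespace Market

variable {Ω : Type*} [mΩ : MeasurableSpace Ω] {M : Market Ω}

namespace Strategy

variable {α : M.Strategy} {t : Icc (0 : ℝ) M.T} {q : State} {ω : Ω}

theorem measurable_time (α : M.Strategy) (n : ℕ) :
    Measurable[(α.isStoppingTime n).measurableSpace] (α.time n) := by
  have h : Measurable fun s : WithTop (Icc (0 : ℝ) M.T) =>
      WithTop.recTopCoe (C := fun _ => ℝ) 0 (fun s : Icc (0 : ℝ) M.T => (s : ℝ)) s :=
    WithTop.measurable_of_measurable_comp_coe (by simpa using measurable_subtype_coe)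
  exact h.comp (α.isStoppingTime n).measurable

theorem measurableSpace_le_of_le (α : M.Strategy) {i n : ℕ} (h : i ≤ n) :
    (α.isStoppingTime i).measurableSpace ≤ (α.isStoppingTime n).measurableSpace :=
  IsStoppingTime.measurableSpace_mono _ _ fun ω => α.mono ω h

theorem measurable_prevTime (α : M.Strategy) (t : Icc (0 : ℝ) M.T) (q : State) (n : ℕ) :
    Measurable[(α.isStoppingTime n).measurableSpace] (α.prevTime t q n) := by
  cases n with
  | zero => exact measurable_const
  | succ n => exact (α.measurable_time n).mono (α.measurableSpace_le_of_le n.le_succ) le_rfl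

theorem measurable_lag (α : M.Strategy) (t : Icc (0 : ℝ) M.T) (q : State) (n : ℕ) :
    Measurable[(α.isStoppingTime n).measurableSpace] (α.lag t q n) := by
  have : α.lag t q n = fun ω => α.time n ω - α.prevTime t q n ω := funext fun ω => α.lag_eq t q n ω
  rw [this]
  exact (α.measurable_time n).sub (α.measurable_prevTime t q n)

/-- The trade of index `n` takes place, at a later time than the preceding one. -/
def Late (α : M.Strategy) (t : Icc (0 : ℝ) M.T) (q : State) (ω : Ω) (n : ℕ) : Prop :=
  α.τ n ω ≠ ⊤ ∧ 0 < α.lag t q n ω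

theorem measurableSet_late (α : M.Strategy) (t : Icc (0 : ℝ) M.T) (q : State) (n : ℕ) :
    MeasurableSet[(α.isStoppingTime n).measurableSpace] {ω | α.Late t q ω n} := by
  refine MeasurableSet.inter (MeasurableSet.compl ?_)
    (measurableSet_lt measurable_const (α.measurable_lag t q n))
  exact (α.isStoppingTime n).measurable (measurableSet_singleton ⊤)

open scoped Classical in
theorem measurable_count_late (α : M.Strategy) (t : Icc (0 : ℝ) M.T) (q : State) (n : ℕ) :
    Measurable[(α.isStoppingTime n).measurableSpace] fun ω => Nat.count (α.Late t q ω) n := by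
  have : (fun ω => Nat.count (α.Late t q ω) n) =
      fun ω => ∑ i ∈ Finset.range n, if α.Late t q ω i then 1 else 0 := by
    funext ω
    rw [Nat.count_eq_card_filter_range, Finset.card_filter]
  rw [this]
  refine Finset.measurable_sum _ fun i hi => Measurable.ite ?_ measurable_const measurable_const
  exact α.measurableSpace_le_of_le (Finset.mem_range.1 hi).le _ (α.measurableSet_late t q i)

open scoped Classical in
/-- The trading times that remain when the trades made at the time of the preceding one are
dropped. The trades of index at least `N` are dropped as well. -/
noncomputable def lateTau (α : M.Strategy) (t : Icc (0 : ℝ) M.T) (q : State) (N k : ℕ) (ω : Ω) :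
    WithTop (Icc (0 : ℝ) M.T) :=
  if k < Nat.count (α.Late t q ω) N then α.τ (Nat.nth (α.Late t q ω) k) ω else ⊤

open scoped Classical in
/-- The amounts of the trades that remain. -/
noncomputable def lateZeta (α : M.Strategy) (t : Icc (0 : ℝ) M.T) (q : State) (N k : ℕ) (ω : Ω) :
    ℝ :=
  if k < Nat.count (α.Late t q ω) N then α.ζ (Nat.nth (α.Late t q ω) k) ω else 0

open scoped Classical in
-- `Nat.nth` refers to the whole sequence of trades, whereas the right-hand side only involves those
-- up to `j`. It therefore shows that the event is known at the time of trade `j`.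
theorem late_nth_eq_iff {N k j : ℕ} (hj : j < N) :
    (k < Nat.count (α.Late t q ω) N ∧ Nat.nth (α.Late t q ω) k = j) ↔
      α.Late t q ω j ∧ Nat.count (α.Late t q ω) j = k := by
  constructor
  · rintro ⟨h, rfl⟩
    obtain ⟨h1, -, h3⟩ := nth_mem_of_lt_count h
    exact ⟨h1, h3⟩
  · rintro ⟨h, rfl⟩
    refine ⟨?_, Nat.nth_count h⟩
    exact Nat.count_strict_mono h hj

open scoped Classical in
theorem measurableSet_late_count (α : M.Strategy) (t : Icc (0 : ℝ) M.T) (q : State) (j k : ℕ) :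
    MeasurableSet[(α.isStoppingTime j).measurableSpace]
      {ω | α.Late t q ω j ∧ Nat.count (α.Late t q ω) j = k} :=
  MeasurableSet.inter (α.measurableSet_late t q j)
    (α.measurable_count_late t q j (measurableSet_singleton k))

open scoped Classical in
theorem lateTau_le_iff {N k : ℕ} {s : Icc (0 : ℝ) M.T} :
    α.lateTau t q N k ω ≤ s ↔ ∃ j < N, (α.Late t q ω j ∧ Nat.count (α.Late t q ω) j = k) ∧
      α.τ j ω ≤ s := by
  constructor
  · intro h
    by_cases hk : k < Nat.count (α.Late t q ω) N
    · have hN := (nth_mem_of_lt_count hk).2.1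
      exact ⟨_, hN, (late_nth_eq_iff hN).1 ⟨hk, rfl⟩, by simpa [lateTau, hk] using h⟩
    · simp [lateTau, hk] at h
  · rintro ⟨j, hj, h, hs⟩
    obtain ⟨hk, rfl⟩ := (late_nth_eq_iff hj).2 h
    simpa [lateTau, hk] using hs

/-- The surviving time is pieced together from the `α.τ j`, over events decided by the time of trade
`j`; there are finitely many pieces because of the cap `N`. -/
theorem isStoppingTime_lateTau (α : M.Strategy) (t : Icc (0 : ℝ) M.T) (q : State) (N k : ℕ) :
    IsStoppingTime M.𝓕 (α.lateTau t q N k) := by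
  classical
  intro s
  have : {ω | α.lateTau t q N k ω ≤ s} = ⋃ j ∈ Finset.range N,
      {ω | α.Late t q ω j ∧ Nat.count (α.Late t q ω) j = k} ∩ {ω | α.τ j ω ≤ s} := by
    ext ω
    simp only [mem_ofPred_eq, lateTau_le_iff, mem_iUnion, Finset.mem_range, mem_inter_iff,
      exists_prop]
  rw [this]
  refine Finset.measurableSet_biUnion _ fun j _ => ?_
  exact ((IsStoppingTime.measurableSet _ _).1 (α.measurableSet_late_count t q j k)).2 s

theorem measurable_lateZeta (α : M.Strategy) (t : Icc (0 : ℝ) M.T) (q : State) (N k : ℕ) :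
    Measurable[(α.isStoppingTime_lateTau t q N k).measurableSpace] (α.lateZeta t q N k) := by
  classical
  intro B hB
  have hk : ∀ j, MeasurableSet[(α.isStoppingTime j).measurableSpace]
      ({ω | α.Late t q ω j ∧ Nat.count (α.Late t q ω) j = k} ∩ α.ζ j ⁻¹' B) := fun j =>
    (α.measurableSet_late_count t q j k).inter (α.measurable_ζ j hB)
  rw [IsStoppingTime.measurableSet]
  constructor
  -- The second part of the union accounts for the default amount `0` when fewer than `k + 1` trades
  -- survive.
  · have : α.lateZeta t q N k ⁻¹' B =
        (⋃ j ∈ Finset.range N,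
          {ω | α.Late t q ω j ∧ Nat.count (α.Late t q ω) j = k} ∩ α.ζ j ⁻¹' B) ∪
        ((⋃ j ∈ Finset.range N, {ω | α.Late t q ω j ∧ Nat.count (α.Late t q ω) j = k})ᶜ ∩
          {_ω | (0 : ℝ) ∈ B}) := by
      ext ω
      simp only [mem_preimage, mem_union, mem_iUnion, Finset.mem_range, mem_inter_iff,
        mem_ofPred_eq, mem_compl_iff, exists_prop, not_exists, not_and]
      by_cases h : k < Nat.count (α.Late t q ω) N
      · have hN := (nth_mem_of_lt_count h).2.1
        have h0 := (late_nth_eq_iff hN).1 ⟨h, rfl⟩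
        simp only [lateZeta, h, if_true]
        constructor
        · exact fun hB => Or.inl ⟨_, hN, h0, hB⟩
        · rintro (⟨j, hj, h1, h2⟩ | ⟨h1, -⟩)
          · obtain ⟨-, rfl⟩ := (late_nth_eq_iff hj).2 h1
            exact h2
          · exact absurd h0.2 (h1 _ hN h0.1)
      · simp only [lateZeta, h, if_false]
        constructor
        · exact fun hB => Or.inr ⟨fun j hj h1 h2 => h ((late_nth_eq_iff hj).2 ⟨h1, h2⟩).1, hB⟩
        · rintro (⟨j, hj, h1, h2⟩ | ⟨-, h1⟩)
          · exact absurd ((late_nth_eq_iff hj).2 h1).1 h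
          · exact h1
    rw [this]
    refine MeasurableSet.union (Finset.measurableSet_biUnion _ fun j _ =>
      (α.isStoppingTime j).measurableSpace_le' _ (hk j)) (MeasurableSet.inter (MeasurableSet.compl
      (Finset.measurableSet_biUnion _ fun j _ => (α.isStoppingTime j).measurableSpace_le' _
        (α.measurableSet_late_count t q j k))) (MeasurableSet.const _))
  · intro s
    have : α.lateZeta t q N k ⁻¹' B ∩ {ω | α.lateTau t q N k ω ≤ s} = ⋃ j ∈ Finset.range N,
        ({ω | α.Late t q ω j ∧ Nat.count (α.Late t q ω) j = k} ∩ α.ζ j ⁻¹' B) ∩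
          {ω | α.τ j ω ≤ s} := by
      ext ω
      simp only [mem_ofPred_eq, lateTau_le_iff, mem_iUnion, Finset.mem_range, mem_inter_iff,
        exists_prop, mem_preimage]
      constructor
      · rintro ⟨h, j, hj, h1, h2⟩
        obtain ⟨h3, h4⟩ := (late_nth_eq_iff hj).2 h1
        refine ⟨j, hj, ⟨h1, ?_⟩, h2⟩
        simpa [lateZeta, h3, h4] using h
      · rintro ⟨j, hj, ⟨h1, h⟩, h2⟩
        obtain ⟨h3, h4⟩ := (late_nth_eq_iff hj).2 h1
        refine ⟨?_, j, hj, h1, h2⟩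
        simpa [lateZeta, h3, h4] using h
    rw [this]
    exact Finset.measurableSet_biUnion _ fun j _ => ((IsStoppingTime.measurableSet _ _).1 (hk j)).2 s

/-- Drop the trades made at the time of the preceding one, and those of index at least `N`. -/
noncomputable def compress (α : M.Strategy) (t : Icc (0 : ℝ) M.T) (q : State) (N : ℕ) :
    M.Strategy where
  τ := α.lateTau t q N
  ζ := α.lateZeta t q N
  isStoppingTime := α.isStoppingTime_lateTau t q N
  mono ω i k hik := by
    classical
    simp only [lateTau]
    by_cases h : k < Nat.count (α.Late t q ω) N
    · rw [if_pos h, if_pos (hik.trans_lt h)]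
      refine α.mono ω ?_
      by_contra! h1
      have h2 := Nat.count_monotone (α.Late t q ω) h1.le
      rw [(nth_mem_of_lt_count h).2.2, (nth_mem_of_lt_count (hik.trans_lt h)).2.2] at h2
      have : i = k := le_antisymm hik h2
      subst this
      exact lt_irrefl _ h1
    · rw [if_neg h]
      exact le_top
  measurable_ζ := α.measurable_lateZeta t q N

theorem compress_tau_eq_top (α : M.Strategy) (t : Icc (0 : ℝ) M.T) (q : State) (N : ℕ) (ω : Ω) :
    (α.compress t q N).τ N ω = ⊤ := by
  classical
  exact if_neg (not_lt.2 (Nat.count_le _))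

section Compress

open scoped Classical in
-- A trade that is not late happens at the time of its predecessor, so going back to the last late
-- trade does not change the time. Consequently the surviving trades keep their lags, and hence
-- their costs.
theorem Feasible.prevTime_eq (h : α.Feasible t q ω) (hθ : 0 ≤ q.θ) (n : ℕ)
    (hn : ∀ i < n, α.τ i ω ≠ ⊤) :
    α.prevTime t q n ω = if Nat.count (α.Late t q ω) n = 0 then (t : ℝ) - q.θ
      else α.time (Nat.nth (α.Late t q ω) (Nat.count (α.Late t q ω) n - 1)) ω := by
  induction n with
  | zero => simp [prevTime]
  | succ n ih =>
    rw [Nat.count_succ]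
    by_cases hl : α.Late t q ω n
    · simp [hl, prevTime, Nat.nth_count hl]
    · have h1 : α.lag t q n ω = 0 :=
        le_antisymm (not_lt.1 fun h2 => hl ⟨hn n n.lt_succ_self, h2⟩)
          (h.lag_nonneg hθ (hn n n.lt_succ_self))
      rw [lag_eq, sub_eq_zero] at h1
      simp only [hl, if_false, add_zero]
      rw [← ih fun i hi => hn i (hi.trans n.lt_succ_self), ← h1]
      rfl

variable {N k : ℕ}

open scoped Classical in
theorem compress_tau (hk : k < Nat.count (α.Late t q ω) N) :
    (α.compress t q N).τ k ω = α.τ (Nat.nth (α.Late t q ω) k) ω :=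
  if_pos hk

open scoped Classical in
theorem compress_tau_ne_top_iff :
    (α.compress t q N).τ k ω ≠ ⊤ ↔ k < Nat.count (α.Late t q ω) N := by
  by_cases hk : k < Nat.count (α.Late t q ω) N
  · rw [compress_tau hk]
    exact ⟨fun _ => hk, fun _ => (nth_mem_of_lt_count hk).1.1⟩
  · have : (α.compress t q N).τ k ω = ⊤ := if_neg hk
    simp [this, hk]

open scoped Classical in
theorem compress_zeta (hk : k < Nat.count (α.Late t q ω) N) :
    (α.compress t q N).ζ k ω = α.ζ (Nat.nth (α.Late t q ω) k) ω :=
  if_pos hk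

open scoped Classical in
theorem compress_time (hk : k < Nat.count (α.Late t q ω) N) :
    (α.compress t q N).time k ω = α.time (Nat.nth (α.Late t q ω) k) ω := by
  rw [time, time, compress_tau hk]

open scoped Classical in
theorem compress_tradePrice (hk : k < Nat.count (α.Late t q ω) N) :
    (α.compress t q N).tradePrice t q k ω = α.tradePrice t q (Nat.nth (α.Late t q ω) k) ω := by
  rw [tradePrice, tradePrice, compress_tau hk]

open scoped Classical in
theorem compress_lag (h : α.Feasible t q ω) (hθ : 0 ≤ q.θ)
    (hk : k < Nat.count (α.Late t q ω) N) :
    (α.compress t q N).lag t q k ω = α.lag t q (Nat.nth (α.Late t q ω) k) ω := by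
  rw [lag_eq, lag_eq, compress_time hk]
  congr 1
  obtain ⟨h1, -, h3⟩ := nth_mem_of_lt_count hk
  rw [h.prevTime_eq hθ _ fun i hi => tau_ne_top_of_le hi.le h1.1, h3]
  cases k with
  | zero => simp [prevTime]
  | succ k => simpa [prevTime] using compress_time (k.lt_succ_self.trans hk)

open scoped Classical in
theorem compress_cost (h : α.Feasible t q ω) (hθ : 0 ≤ q.θ)
    (hk : k < Nat.count (α.Late t q ω) N) :
    (α.compress t q N).cost t q k ω = α.cost t q (Nat.nth (α.Late t q ω) k) ω := by
  rw [cost, cost, compress_zeta hk, compress_tradePrice hk, compress_lag h hθ hk]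

theorem zeta_eq_zero_of_not_late (h : α.Feasible t q ω) (hθ : 0 ≤ q.θ)
    (h0 : ∀ n, α.τ n ω ≠ ⊤ → α.lag t q n ω = 0 → α.ζ n ω = 0) {n : ℕ} (hn : α.τ n ω ≠ ⊤)
    (hl : ¬ α.Late t q ω n) : α.ζ n ω = 0 :=
  h0 n hn (le_antisymm (not_lt.1 fun h2 => hl ⟨hn, h2⟩) (h.lag_nonneg hθ hn))

theorem cost_eq_zero_of_zeta_eq_zero {n : ℕ} (h : α.ζ n ω = 0) : α.cost t q n ω = 0 := by
  simp [cost, h]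

open scoped Classical in
theorem compress_sum {g g' : ℕ → ℝ} (hg : ∀ k < Nat.count (α.Late t q ω) N,
      g' k = g (Nat.nth (α.Late t q ω) k))
    (h0 : ∀ n, α.τ n ω ≠ ⊤ → ¬ α.Late t q ω n → g n = 0)
    (hk : k < Nat.count (α.Late t q ω) N) :
    ∑ i ∈ Finset.range (k + 1), g' i =
      ∑ j ∈ Finset.range (Nat.nth (α.Late t q ω) k + 1), g j := by
  obtain ⟨h1, -, h3⟩ := nth_mem_of_lt_count hk
  have hc : k + 1 = Nat.count (α.Late t q ω) (Nat.nth (α.Late t q ω) k + 1) := by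
    rw [Nat.count_succ, h3, if_pos h1]
  calc _ = ∑ i ∈ Finset.range (k + 1), g (Nat.nth (α.Late t q ω) i) := by
        refine Finset.sum_congr rfl fun i hi => hg i ?_
        have := Finset.mem_range.1 hi
        omega
    _ = _ := by
        rw [hc, sum_nth]
        refine Finset.sum_congr rfl fun j hj => ?_
        split_ifs with hl
        · rfl
        · refine (h0 j (tau_ne_top_of_le ?_ h1.1) hl).symm
          exact Nat.lt_succ_iff.1 (Finset.mem_range.1 hj)

theorem compress_tsum (hN : α.τ N ω = ⊤) {g g' : ℕ → ℝ}
    (hg : ∀ k, (α.compress t q N).τ k ω ≠ ⊤ → g' k = g (Nat.nth (α.Late t q ω) k))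
    (h0 : ∀ n, α.τ n ω ≠ ⊤ → ¬ α.Late t q ω n → g n = 0) (s : Icc (0 : ℝ) M.T) :
    (∑' k, if (α.compress t q N).τ k ω ≤ (s : WithTop (Icc (0 : ℝ) M.T)) then g' k else 0) =
      ∑' k, if α.τ k ω ≤ (s : WithTop (Icc (0 : ℝ) M.T)) then g k else 0 := by
  classical
  set G : ℕ → ℝ := fun k => if α.τ k ω ≤ (s : WithTop (Icc (0 : ℝ) M.T)) then g k else 0
    with hG
  rw [tsum_eq_sum (s := Finset.range (Nat.count (α.Late t q ω) N)),
    tsum_eq_sum (s := Finset.range N) (f := G)]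
  · calc _ = ∑ k ∈ Finset.range (Nat.count (α.Late t q ω) N), G (Nat.nth (α.Late t q ω) k) := by
          refine Finset.sum_congr rfl fun k hk => ?_
          have hk := Finset.mem_range.1 hk
          rw [compress_tau hk, hg k (compress_tau_ne_top_iff.2 hk)]
      _ = _ := by
          rw [sum_nth]
          refine Finset.sum_congr rfl fun j _ => ?_
          split_ifs with hl
          · rfl
          · by_cases hj : α.τ j ω ≤ s
            · simp [hG, h0 j (tau_le_iff.1 hj).1 hl]
            · simp [hG, hj]
  · intro k hk
    refine if_neg fun h => (tau_le_iff.1 h).1 (tau_eq_top_of_le ?_ hN)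
    simpa using hk
  · intro k hk
    refine if_neg fun h => hk ?_
    exact Finset.mem_range.2 (compress_tau_ne_top_iff.1 (tau_le_iff.1 h).1)

/-- The dropped trades have amount zero, and the elapsed time depends only on the set of trading
times, from which only repetitions disappear. -/
theorem compress_state (h : α.Feasible t q ω) (hθ : 0 ≤ q.θ) (hN : α.τ N ω = ⊤)
    (h0 : ∀ n, α.τ n ω ≠ ⊤ → α.lag t q n ω = 0 → α.ζ n ω = 0) (s : Icc (0 : ℝ) M.T) :
    (α.compress t q N).state t q s ω = α.state t q s ω := by
  classical
  ext
  · simp only [state]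
    rw [compress_tsum hN (fun k hk => compress_cost h hθ (compress_tau_ne_top_iff.1 hk))
      fun n hn hl => cost_eq_zero_of_zeta_eq_zero (zeta_eq_zero_of_not_late h hθ h0 hn hl)]
  · simp only [state]
    rw [compress_tsum hN (fun k hk => compress_zeta (compress_tau_ne_top_iff.1 hk))
      fun n hn hl => zeta_eq_zero_of_not_late h hθ h0 hn hl]
  · rfl
  · simp only [state]
    congr 1
    ext r
    simp only [mem_insert_iff, mem_ofPred_eq]
    refine or_congr_right' fun hr => ⟨?_, ?_⟩
    · rintro ⟨k, hk, rfl⟩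
      have hk' := compress_tau_ne_top_iff.1 (tau_le_iff.1 hk).1
      exact ⟨_, compress_tau hk' ▸ hk, by rw [compress_time hk']⟩
    · rintro ⟨n, hn, rfl⟩
      have hn0 := (tau_le_iff.1 hn).1
      have hp := h.prevTime_eq hθ (n + 1)
        fun i hi => tau_ne_top_of_le (Nat.lt_succ_iff.1 hi) hn0
      have hnN : n < N := not_le.1 fun h => hn0 (tau_eq_top_of_le h hN)
      change α.time n ω = _ at hp
      split_ifs at hp with hc
      -- With no late trade up to `n`, trade `n` happens at `t - θ` and gives the inserted element
      -- of the set, which `hr` excludes.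
      · exact absurd (by rw [hp]) hr
      · set k := Nat.count (α.Late t q ω) (n + 1) - 1 with hk
        have hk1 : k < Nat.count (α.Late t q ω) (n + 1) := by omega
        have hk2 : k < Nat.count (α.Late t q ω) N :=
          hk1.trans_le (Nat.count_monotone _ hnN)
        refine ⟨k, ?_, by rw [compress_time hk2, hp]⟩
        rw [compress_tau hk2]
        exact (α.mono ω (Nat.lt_succ_iff.1 (nth_mem_of_lt_count hk1).2.1)).trans hn

theorem compress_stateAfter (h : α.Feasible t q ω) (hθ : 0 ≤ q.θ)
    (h0 : ∀ n, α.τ n ω ≠ ⊤ → α.lag t q n ω = 0 → α.ζ n ω = 0)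
    (hk : (α.compress t q N).τ k ω ≠ ⊤) :
    (α.compress t q N).stateAfter t q k ω =
      α.stateAfter t q (Nat.nth (α.Late t q ω) k) ω := by
  classical
  have hk' := compress_tau_ne_top_iff.1 hk
  ext
  · simp only [stateAfter]
    rw [compress_sum (fun i hi => compress_cost h hθ hi)
      (fun n hn hl => cost_eq_zero_of_zeta_eq_zero (zeta_eq_zero_of_not_late h hθ h0 hn hl)) hk']
  · simp only [stateAfter]
    rw [compress_sum (fun i hi => compress_zeta hi)
      (fun n hn hl => zeta_eq_zero_of_not_late h hθ h0 hn hl) hk']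
  · exact compress_tradePrice hk'
  · rfl

theorem compress_finiteLiquidating {μ : Measure Ω} (hθ : 0 ≤ q.θ) (h : α.Liquidating μ t q)
    (hN : ∀ ω, α.τ N ω = ⊤)
    (h0 : ∀ᵐ ω ∂μ, ∀ n, α.τ n ω ≠ ⊤ → α.lag t q n ω = 0 → α.ζ n ω = 0) :
    (α.compress t q N).FiniteLiquidating μ t q := by
  classical
  refine ⟨⟨?_, ?_⟩, ?_⟩
  · filter_upwards [h.1, h.1.feasible, h0] with ω ⟨h1, h2, h3⟩ hf h0
    refine ⟨fun n => ?_, fun n hn => ?_, fun s hs => ?_⟩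
    · by_cases hn : n < Nat.count (α.Late t q ω) N
      · rw [compress_tau hn]
        exact h1 _
      · rw [not_not.1 fun h => hn (compress_tau_ne_top_iff.1 h)]
        exact le_top
    · have hn' := compress_tau_ne_top_iff.1 hn
      rw [compress_zeta hn', compress_lag hf hθ hn', compress_stateAfter hf hθ h0 hn]
      exact h2 _ (nth_mem_of_lt_count hn').1.1
    · rw [compress_state hf hθ (hN ω) h0]
      exact h3 s hs
  · filter_upwards [h.2, h.1.feasible, h0] with ω h2 hf h0
    rw [compress_state hf hθ (hN ω) h0]
    exact h2
  · filter_upwards [h.1.feasible] with ω hf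
    refine ⟨(numTrades_le (α.compress_tau_eq_top t q N ω)).trans_lt (by simp), fun n hn => ?_⟩
    have hn' := compress_tau_ne_top_iff.1 hn
    rw [compress_lag hf hθ hn']
    exact (nth_mem_of_lt_count hn').1.2

end Compress

end Strategy

end Market
end IlliquidMarket

/-! ### Construction of the approximating strategy -/

namespace IlliquidMarket
namespace Market

variable {Ω : Type*} [mΩ : MeasurableSpace Ω] {M : Market Ω}

/-! ### Choosing a sale among finitely many -/

/-- The proceeds of a sale of `r` shares at unit price. -/
noncomputable def proceeds (M : Market Ω) (r g : ℝ) : ℝ := r * (M.f (-r) g).toReal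

/-- The best among the sales of `(k / m) y` shares, `k ≤ n`. -/
noncomputable def bestSale (M : Market Ω) (m : ℕ) (y g : ℝ) : ℕ → ℝ
  | 0 => 0
  | n + 1 =>
    if M.proceeds (M.bestSale m y g n) g < M.proceeds (((n + 1 : ℕ) : ℝ) / m * y) g then
      ((n + 1 : ℕ) : ℝ) / m * y else M.bestSale m y g n

theorem proceeds_le_bestSale {m k n : ℕ} (hk : k ≤ n) (y g : ℝ) :
    M.proceeds ((k : ℝ) / m * y) g ≤ M.proceeds (M.bestSale m y g n) g := by
  induction n with
  | zero =>
    obtain rfl : k = 0 := by omega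
    simp [bestSale]
  | succ n ih =>
    simp only [bestSale]
    rcases hk.eq_or_lt with rfl | hk
    · split_ifs with h
      · exact le_rfl
      · exact not_lt.1 h
    · split_ifs with h
      · exact (ih (by omega)).trans h.le
      · exact ih (by omega)

theorem bestSale_mem {m n : ℕ} (hn : n ≤ m) {y : ℝ} (hy : 0 ≤ y) (g : ℝ) :
    M.bestSale m y g n ∈ Icc 0 y := by
  induction n with
  | zero => simp [bestSale, hy]
  | succ n ih =>
    simp only [bestSale]
    split_ifs
    · refine ⟨by positivity, mul_le_of_le_one_left hy ?_⟩
      exact div_le_one_of_le₀ (by exact_mod_cast hn) (by positivity)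
    · exact ih (by omega)

theorem measurable_proceeds (hf : M.ImpactMonotone) :
    Measurable fun q : ℝ × ℝ => M.proceeds q.1 q.2 := by
  have : Measurable fun q : ℝ × ℝ => M.f (-q.1) q.2 :=
    hf.measurable.comp (measurable_fst.neg.prodMk measurable_snd)
  exact measurable_fst.mul this.ennreal_toReal

/-- A running maximum over a finite grid is Borel by construction; maximizing over all sales would
raise questions of attainment and of measurable selection. -/
theorem measurable_bestSale (hf : M.ImpactMonotone) (m n : ℕ) :
    Measurable fun q : ℝ × ℝ => M.bestSale m q.1 q.2 n := by
  induction n with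
  | zero => exact measurable_const
  | succ n ih =>
    simp only [bestSale]
    have h1 : Measurable fun q : ℝ × ℝ => ((n + 1 : ℕ) : ℝ) / m * q.1 :=
      measurable_fst.const_mul _
    refine Measurable.ite (measurableSet_lt ?_ ?_) h1 ih
    · exact (measurable_proceeds hf).comp (ih.prodMk measurable_snd)
    · exact (measurable_proceeds hf).comp (h1.prodMk measurable_snd)

namespace Strategy

variable {α : M.Strategy} {t : Icc (0 : ℝ) M.T} {q : State} {ω : Ω}

/-! ### Keeping finitely many trades -/

/-- The first `m` trades of a strategy. -/
noncomputable def truncate (α : M.Strategy) (m : ℕ) : M.Strategy where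
  τ n ω := if n < m then α.τ n ω else ⊤
  ζ := α.ζ
  isStoppingTime n := by
    split_ifs
    · exact α.isStoppingTime n
    · intro i
      simp
  mono ω i n h := by
    dsimp only
    split_ifs with h1 h2
    · exact α.mono ω h
    · exact le_top
    · omega
    · exact le_rfl
  measurable_ζ n := by
    refine (α.measurable_ζ n).mono (IsStoppingTime.measurableSpace_mono _ _ fun ω => ?_) le_rfl
    dsimp only
    split_ifs
    · exact le_rfl
    · exact le_top

theorem truncate_tau {m n : ℕ} (h : n < m) : (α.truncate m).τ n ω = α.τ n ω := if_pos h

theorem truncate_tau_eq_top {m n : ℕ} (h : m ≤ n) : (α.truncate m).τ n ω = ⊤ :=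
  if_neg (not_lt.2 h)

theorem truncate_time {m n : ℕ} (h : n < m) : (α.truncate m).time n ω = α.time n ω := by
  rw [time, time, truncate_tau h]

theorem truncate_lag {m n : ℕ} (h : n < m) : (α.truncate m).lag t q n ω = α.lag t q n ω := by
  cases n with
  | zero => simp only [lag, truncate_time h]
  | succ n => simp only [lag, truncate_time h, truncate_time (n.lt_succ_self.trans h)]

theorem truncate_cost {m n : ℕ} (h : n < m) :
    (α.truncate m).cost t q n ω = α.cost t q n ω := by
  have hζ : (α.truncate m).ζ n ω = α.ζ n ω := rfl
  rw [cost, cost, truncate_lag h, tradePrice, tradePrice, truncate_tau h, hζ]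

/-- At least one index has to be kept: otherwise the solvency required before the first trade would
have to hold up to `T` without any trade. -/
theorem Feasible.truncate (h : α.Feasible t q ω) {m : ℕ} (hm : 0 < m) :
    (α.truncate m).Feasible t q ω := by
  have hlt : ∀ n, (α.truncate m).τ n ω ≠ ⊤ → n < m := fun n hn =>
    not_le.1 fun h => hn (truncate_tau_eq_top h)
  refine ⟨fun n => ?_, fun n hn => ?_, fun s hs hlt => h.2.2 s hs ?_⟩
  · by_cases hn : n < m
    · rw [truncate_tau hn]
      exact h.1 n
    · rw [truncate_tau_eq_top (not_lt.1 hn)]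
      exact le_top
  · have hnm := hlt n hn
    have hn' : α.τ n ω ≠ ⊤ := by rwa [truncate_tau hnm] at hn
    have hs : (α.truncate m).stateAfter t q n ω = α.stateAfter t q n ω := by
      ext
      · simp only [stateAfter]
        congr 1
        exact Finset.sum_congr rfl fun k hk =>
          truncate_cost (lt_of_lt_of_le (Finset.mem_range.1 hk) hnm)
      · rfl
      · simp only [stateAfter, tradePrice, truncate_tau hnm]
      · rfl
    rw [hs, truncate_lag hnm]
    exact h.2.1 n hn'
  · rwa [truncate_tau hm] at hlt

/-! ### Liquidating early -/

/-- The trading times `τⱼ ∧ u`. -/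
noncomputable def minTau (α : M.Strategy) (u : Icc (0 : ℝ) M.T) (j : ℕ) (ω : Ω) :
    WithTop (Icc (0 : ℝ) M.T) := min (α.τ j ω) u

theorem isStoppingTime_minTau (α : M.Strategy) (u : Icc (0 : ℝ) M.T) (j : ℕ) :
    IsStoppingTime M.𝓕 (α.minTau u j) :=
  (α.isStoppingTime j).min_const u

theorem minTau_mono (α : M.Strategy) (u : Icc (0 : ℝ) M.T) {i j : ℕ} (h : i ≤ j) (ω : Ω) :
    α.minTau u i ω ≤ α.minTau u j ω :=
  min_le_min_right _ (α.mono ω h)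

theorem measurableSpace_minTau_mono (α : M.Strategy) (u : Icc (0 : ℝ) M.T) {i j : ℕ}
    (h : i ≤ j) : (α.isStoppingTime_minTau u i).measurableSpace ≤
      (α.isStoppingTime_minTau u j).measurableSpace :=
  IsStoppingTime.measurableSpace_mono _ _ fun ω => α.minTau_mono u h ω

/-- The time `τⱼ ∧ u` as a real number. -/
noncomputable def minTime (α : M.Strategy) (u : Icc (0 : ℝ) M.T) (j : ℕ) (ω : Ω) : ℝ :=
  WithTop.recTopCoe (C := fun _ => ℝ) 0 (fun s : Icc (0 : ℝ) M.T => (s : ℝ)) (α.minTau u j ω)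

theorem measurable_minTime (α : M.Strategy) (u : Icc (0 : ℝ) M.T) (j : ℕ) :
    Measurable[(α.isStoppingTime_minTau u j).measurableSpace] (α.minTime u j) := by
  have h : Measurable fun s : WithTop (Icc (0 : ℝ) M.T) =>
      WithTop.recTopCoe (C := fun _ => ℝ) 0 (fun s : Icc (0 : ℝ) M.T => (s : ℝ)) s :=
    WithTop.measurable_of_measurable_comp_coe (by simpa using measurable_subtype_coe)
  exact h.comp (α.isStoppingTime_minTau u j).measurable

/-- The lags of the trading times `τⱼ ∧ u`. -/
noncomputable def minLag (α : M.Strategy) (t : Icc (0 : ℝ) M.T) (q : State)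
    (u : Icc (0 : ℝ) M.T) : ℕ → Ω → ℝ
  | 0, ω => α.minTime u 0 ω - ((t : ℝ) - q.θ)
  | n + 1, ω => α.minTime u (n + 1) ω - α.minTime u n ω

theorem measurable_minLag (α : M.Strategy) (t : Icc (0 : ℝ) M.T) (q : State)
    (u : Icc (0 : ℝ) M.T) (j : ℕ) :
    Measurable[(α.isStoppingTime_minTau u j).measurableSpace] (α.minLag t q u j) := by
  cases j with
  | zero => exact (α.measurable_minTime u 0).sub measurable_const
  | succ j =>
    exact (α.measurable_minTime u (j + 1)).sub
      ((α.measurable_minTime u j).mono (α.measurableSpace_minTau_mono u j.le_succ) le_rfl)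

open scoped Classical in
/-- The amount of a trade made at time `u` at the latest and later than the preceding one. -/
noncomputable def kept (α : M.Strategy) (t : Icc (0 : ℝ) M.T) (q : State)
    (u : Icc (0 : ℝ) M.T) (j : ℕ) (ω : Ω) : ℝ :=
  if α.τ j ω ≤ u then if 0 < α.lag t q j ω then α.ζ j ω else 0 else 0

theorem measurableSet_tau_le (α : M.Strategy) (u : Icc (0 : ℝ) M.T) (j : ℕ) :
    MeasurableSet[(α.isStoppingTime_minTau u j).measurableSpace] {ω | α.τ j ω ≤ u} := by
  have h := (α.isStoppingTime j).measurableSet_inter_le_const_iff univ u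
  simp only [univ_inter] at h
  exact h.1 ((α.isStoppingTime j).measurableSet_le' u)

/-- On the event that the trade is made by time `u`, the σ-algebras at `τ j` and at `τ j ∧ u` have
the same trace; off this event the amount is constant. -/
theorem measurable_kept (α : M.Strategy) (t : Icc (0 : ℝ) M.T) (q : State)
    (u : Icc (0 : ℝ) M.T) (j : ℕ) :
    Measurable[(α.isStoppingTime_minTau u j).measurableSpace] (α.kept t q u j) := by
  classical
  have hg : Measurable[(α.isStoppingTime j).measurableSpace]
      fun ω => if 0 < α.lag t q j ω then α.ζ j ω else 0 :=
    Measurable.ite (measurableSet_lt measurable_const (α.measurable_lag t q j))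
      (α.measurable_ζ j) measurable_const
  intro B hB
  have : α.kept t q u j ⁻¹' B =
      ((fun ω => if 0 < α.lag t q j ω then α.ζ j ω else 0) ⁻¹' B ∩ {ω | α.τ j ω ≤ u}) ∪
        ({ω | α.τ j ω ≤ u}ᶜ ∩ {_ω | (0 : ℝ) ∈ B}) := by
    ext ω
    by_cases h : α.τ j ω ≤ u <;> simp [kept, h]
  rw [this]
  refine MeasurableSet.union ?_ (MeasurableSet.inter (MeasurableSet.compl ?_) (.const _))
  · exact ((α.isStoppingTime j).measurableSet_inter_le_const_iff _ u).1
      ((hg hB).inter ((α.isStoppingTime j).measurableSet_le' u))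
  · exact α.measurableSet_tau_le u j

open scoped Classical in
/-- Follow `α` until time `u`, then, unless a trade is made at time `u`, make at this time the best
sale among finitely many. -/
noncomputable def cutZeta (α : M.Strategy) (t : Icc (0 : ℝ) M.T) (q : State)
    (u : Icc (0 : ℝ) M.T) (m j : ℕ) (ω : Ω) : ℝ :=
  if α.τ j ω ≤ u then α.kept t q u j ω
  else if 0 < α.minLag t q u j ω then
    -M.bestSale m (q.y + ∑ i ∈ Finset.range j, α.kept t q u i ω) (α.minLag t q u j ω) m
  else 0

/-- The sale at `u` depends only on the current holdings and on the current lag, both known at `τ j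
∧ u`. -/
theorem measurable_cutZeta (hf : M.ImpactMonotone) (α : M.Strategy) (t : Icc (0 : ℝ) M.T)
    (q : State) (u : Icc (0 : ℝ) M.T) (m j : ℕ) :
    Measurable[(α.isStoppingTime_minTau u j).measurableSpace] (α.cutZeta t q u m j) := by
  refine Measurable.ite (α.measurableSet_tau_le u j) (α.measurable_kept t q u j)
    (Measurable.ite (measurableSet_lt measurable_const (α.measurable_minLag t q u j)) ?_
      measurable_const)
  have h1 : Measurable[(α.isStoppingTime_minTau u j).measurableSpace]
      fun ω => q.y + ∑ i ∈ Finset.range j, α.kept t q u i ω :=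
    Measurable.const_add (Finset.measurable_sum _ fun i hi => (α.measurable_kept t q u i).mono
      (α.measurableSpace_minTau_mono u (Finset.mem_range.1 hi).le) le_rfl) _
  exact ((measurable_bestSale hf m m).comp (h1.prodMk (α.measurable_minLag t q u j))).neg

/-- The trading times of the strategy `cut`. -/
noncomputable def cutTau (α : M.Strategy) (u : Icc (0 : ℝ) M.T) (m j : ℕ) (ω : Ω) :
    WithTop (Icc (0 : ℝ) M.T) :=
  if j ≤ m then α.minTau u j ω else if j = m + 1 then M.terminal else ⊤

theorem isStoppingTime_cutTau (α : M.Strategy) (u : Icc (0 : ℝ) M.T) (m j : ℕ) :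
    IsStoppingTime M.𝓕 (α.cutTau u m j) := by
  unfold cutTau
  split_ifs
  · exact α.isStoppingTime_minTau u j
  · exact isStoppingTime_const _ _
  · intro i
    simp

theorem le_terminal (s : Icc (0 : ℝ) M.T) : s ≤ M.terminal := s.2.2

theorem minTau_le_terminal (α : M.Strategy) (u : Icc (0 : ℝ) M.T) (j : ℕ) (ω : Ω) :
    α.minTau u j ω ≤ M.terminal :=
  (min_le_right _ _).trans (WithTop.coe_le_coe.2 (le_terminal u))

/-- Keep the trades of `α` made at time `u` at the latest and later than the preceding one, make
a well-chosen sale at time `u`, and sell all the shares at the final time. It is assumed that `α`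
has at most `m` trades. -/
noncomputable def cut (hf : M.ImpactMonotone) (α : M.Strategy) (t : Icc (0 : ℝ) M.T) (q : State)
    (u : Icc (0 : ℝ) M.T) (m : ℕ) : M.Strategy where
  τ := α.cutTau u m
  ζ j ω := if j ≤ m then α.cutZeta t q u m j ω
    else if j = m + 1 then -(q.y + ∑ i ∈ Finset.range (m + 1), α.cutZeta t q u m i ω) else 0
  isStoppingTime := α.isStoppingTime_cutTau u m
  mono ω i j h := by
    simp only [cutTau]
    split_ifs with h1 h2 h3 h4
    · exact α.minTau_mono u h ω
    · exact α.minTau_le_terminal u i ω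
    · exact le_top
    · omega
    · exact le_rfl
    · exact le_top
    · omega
    · omega
    · exact le_rfl
  measurable_ζ j := by
    by_cases h1 : j ≤ m
    · simp only [h1, if_true]
      refine (α.measurable_cutZeta hf t q u m j).mono
        (IsStoppingTime.measurableSpace_mono _ _ fun ω => ?_) le_rfl
      simp [cutTau, h1]
    · by_cases h2 : j = m + 1
      · subst h2
        simp only [h1, if_true, if_false]
        refine (Measurable.const_add (Finset.measurable_sum _ fun i hi =>
          (α.measurable_cutZeta hf t q u m i).mono
            (IsStoppingTime.measurableSpace_mono _ _ fun ω => ?_) le_rfl) _).neg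
        simpa [cutTau] using α.minTau_le_terminal u i ω
      · simp only [h1, h2, if_false]
        exact measurable_const

end Strategy

end Market
end IlliquidMarket

/-! ### Cash, shares and solvency of the cut strategy -/

namespace IlliquidMarket
namespace Market

variable {Ω : Type*} [mΩ : MeasurableSpace Ω] {M : Market Ω}

namespace Strategy

variable {α : M.Strategy} {t u : Icc (0 : ℝ) M.T} {q : State} {ω : Ω} {m c : ℕ}
  {hf : M.ImpactMonotone}

section Cut

theorem cut_tau_of_le {i : ℕ} (hi : i ≤ m) (h : α.τ i ω ≤ u) :
    (α.cut hf t q u m).τ i ω = α.τ i ω := by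
  simp only [cut, cutTau, minTau, if_pos hi, min_eq_left h]

theorem cut_tau_of_gt {i : ℕ} (hi : i ≤ m) (h : u < α.τ i ω) :
    (α.cut hf t q u m).τ i ω = u := by
  simp only [cut, cutTau, minTau, if_pos hi, min_eq_right h.le]

theorem cut_tau_last : (α.cut hf t q u m).τ (m + 1) ω = M.terminal := by
  simp [cut, cutTau]

theorem cut_tau_eq_top : (α.cut hf t q u m).τ (m + 2) ω = ⊤ := by
  simp [cut, cutTau]

theorem cut_tau_ne_top_iff {i : ℕ} : (α.cut hf t q u m).τ i ω ≠ ⊤ ↔ i ≤ m + 1 := by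
  constructor
  · intro h
    by_contra! hi
    exact h (tau_eq_top_of_le hi cut_tau_eq_top)
  · intro h
    exact tau_ne_top_of_le h (by simp [cut_tau_last])

theorem cut_zeta_last : (α.cut hf t q u m).ζ (m + 1) ω =
    -(q.y + ∑ i ∈ Finset.range (m + 1), (α.cut hf t q u m).ζ i ω) := by
  have h : ∑ i ∈ Finset.range (m + 1), (α.cut hf t q u m).ζ i ω =
      ∑ i ∈ Finset.range (m + 1), α.cutZeta t q u m i ω :=
    Finset.sum_congr rfl fun i hi => if_pos (Nat.lt_succ_iff.1 (Finset.mem_range.1 hi))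
  rw [h]
  simp [cut]

theorem cut_time_of_le {i : ℕ} (hi : i ≤ m) (h : α.τ i ω ≤ u) :
    (α.cut hf t q u m).time i ω = α.time i ω := by
  rw [time, time, cut_tau_of_le hi h]

theorem cut_lag_of_le {i : ℕ} (hi : i ≤ m) (h : α.τ i ω ≤ u) :
    (α.cut hf t q u m).lag t q i ω = α.lag t q i ω := by
  cases i with
  | zero => simp only [lag, cut_time_of_le hi h]
  | succ i =>
    simp only [lag, cut_time_of_le hi h,
      cut_time_of_le (i.le_succ.trans hi) ((α.mono ω i.le_succ).trans h)]

theorem cut_tradePrice_of_le {i : ℕ} (hi : i ≤ m) (h : α.τ i ω ≤ u) :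
    (α.cut hf t q u m).tradePrice t q i ω = α.tradePrice t q i ω := by
  rw [tradePrice, tradePrice, cut_tau_of_le hi h]

open scoped Classical in
theorem cut_zeta_of_le {i : ℕ} (hi : i ≤ m) (h : α.τ i ω ≤ u) :
    (α.cut hf t q u m).ζ i ω = if 0 < α.lag t q i ω then α.ζ i ω else 0 := by
  simp only [cut, if_pos hi, cutZeta, kept, if_pos h]

/-- A trade kept by `cut` costs as much as before; the free sales are dropped. -/
theorem cut_trade_of_le (h2 : M.ImpactImmediate) (h : α.Feasible t q ω) (hθ : 0 ≤ q.θ) {i : ℕ}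
    (hi : i ≤ m) (hiu : α.τ i ω ≤ u) :
    α.ζ i ω ≤ (α.cut hf t q u m).ζ i ω ∧
      (α.cut hf t q u m).cost t q i ω = α.cost t q i ω ∧
      M.f ((α.cut hf t q u m).ζ i ω) (α.lag t q i ω) ≠ ∞ := by
  have hn := (tau_le_iff.1 hiu).1
  have hfin := (h.2.1 i hn).1
  simp only [cost, cut_zeta_of_le hi hiu, cut_lag_of_le hi hiu, cut_tradePrice_of_le hi hiu]
  split_ifs with hl
  · exact ⟨le_rfl, rfl, hfin⟩
  · have hl0 : α.lag t q i ω = 0 := le_antisymm (not_lt.1 hl) (h.lag_nonneg hθ hn)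
    obtain ⟨h3, h4⟩ := cost_eq_zero_of_lag_eq_zero h2 hfin hl0
    refine ⟨h3, by rw [cost] at h4; simp [h4], ?_⟩
    rw [hl0, hf.zero 0 (left_mem_Icc.2 M.T_pos.le)]
    exact ENNReal.one_ne_top

/-- The index `c` is that of the first trade after time `u`. -/
structure IsFirstAfter (α : M.Strategy) (u : Icc (0 : ℝ) M.T) (ω : Ω) (c : ℕ) : Prop where
  lt : u < α.τ c ω
  le : ∀ i < c, α.τ i ω ≤ u

theorem exists_isFirstAfter (hm : α.τ m ω = ⊤) (u : Icc (0 : ℝ) M.T) :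
    ∃ c ≤ m, α.IsFirstAfter u ω c := by
  classical
  have hex : ∃ n, (u : WithTop (Icc (0 : ℝ) M.T)) < α.τ n ω := ⟨m, by simp [hm]⟩
  exact ⟨Nat.find hex, Nat.find_min' hex (by simp [hm]), Nat.find_spec hex,
    fun i hi => not_lt.1 (Nat.find_min hex hi)⟩

theorem IsFirstAfter.tau_gt (hc : α.IsFirstAfter u ω c) {i : ℕ} (hi : c ≤ i) : u < α.τ i ω :=
  hc.lt.trans_le (α.mono ω hi)

theorem cut_time_of_gt {i : ℕ} (hi : i ≤ m) (h : u < α.τ i ω) :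
    (α.cut hf t q u m).time i ω = u :=
  time_of_eq (cut_tau_of_gt hi h)

theorem cut_lag_eq_minLag {i : ℕ} (hi : i ≤ m) :
    (α.cut hf t q u m).lag t q i ω = α.minLag t q u i ω := by
  have key : ∀ j ≤ m, (α.cut hf t q u m).time j ω = α.minTime u j ω := fun j hj => by
    simp [time, minTime, cut, cutTau, hj]
  cases i with
  | zero => simp only [lag, minLag, key 0 hi]
  | succ i => simp only [lag, minLag, key _ hi, key i (i.le_succ.trans hi)]

theorem cut_zeta_lt (hc : α.IsFirstAfter u ω c) (hcm : c ≤ m) {i : ℕ} (hi : i < c) :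
    (α.cut hf t q u m).ζ i ω = α.kept t q u i ω := by
  simp only [cut, if_pos (hi.le.trans hcm), cutZeta, if_pos (hc.le i hi)]

theorem cut_lag_first (hc : α.IsFirstAfter u ω c) (hcm : c ≤ m) :
    (α.cut hf t q u m).lag t q c ω = u - α.prevTime t q c ω := by
  cases c with
  | zero => simp only [lag, cut_time_of_gt hcm hc.lt, prevTime]
  | succ c =>
    simp only [lag, cut_time_of_gt hcm hc.lt, prevTime,
      cut_time_of_le (c.le_succ.trans hcm) (hc.le c c.lt_succ_self)]

theorem cut_zeta_first (hc : α.IsFirstAfter u ω c) (hcm : c ≤ m) :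
    (α.cut hf t q u m).ζ c ω = if 0 < (α.cut hf t q u m).lag t q c ω then
      -M.bestSale m (q.y + ∑ i ∈ Finset.range c, (α.cut hf t q u m).ζ i ω)
        ((α.cut hf t q u m).lag t q c ω) m else 0 := by
  have h1 : ∑ i ∈ Finset.range c, (α.cut hf t q u m).ζ i ω =
      ∑ i ∈ Finset.range c, α.kept t q u i ω :=
    Finset.sum_congr rfl fun i hi => cut_zeta_lt hc hcm (Finset.mem_range.1 hi)
  rw [h1, cut_lag_eq_minLag hcm]
  simp only [cut, if_pos hcm, cutZeta, if_neg (not_le.2 hc.lt)]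

theorem cut_lag_between (hc : α.IsFirstAfter u ω c) {i : ℕ} (hci : c < i) (hi : i ≤ m) :
    (α.cut hf t q u m).lag t q i ω = 0 := by
  obtain ⟨i, rfl⟩ := Nat.exists_eq_succ_of_ne_zero (Nat.ne_zero_of_lt hci)
  simp only [lag, cut_time_of_gt hi (hc.tau_gt hci.le),
    cut_time_of_gt (i.le_succ.trans hi) (hc.tau_gt (Nat.lt_succ_iff.1 hci)), sub_self]

/-- All indices from `c` to `m` are moved to time `u`, so those after `c` have zero lag and carry no
trade. Thus at most one sale is added at `u`. -/
theorem cut_zeta_between (hc : α.IsFirstAfter u ω c) {i : ℕ} (hci : c < i) (hi : i ≤ m) :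
    (α.cut hf t q u m).ζ i ω = 0 := by
  have h1 : ¬ 0 < α.minLag t q u i ω := by
    rw [← cut_lag_eq_minLag (hf := hf) hi, cut_lag_between hc hci hi]
    exact lt_irrefl _
  simp only [cut, if_pos hi, cutZeta, if_neg (not_le.2 (hc.tau_gt hci.le)), if_neg h1]

theorem cut_lag_last (hc : α.IsFirstAfter u ω c) (hcm : c ≤ m) :
    (α.cut hf t q u m).lag t q (m + 1) ω = M.T - u := by
  simp only [lag, time_of_eq cut_tau_last, cut_time_of_gt le_rfl (hc.tau_gt hcm)]
  rfl

theorem sum_range_eq_of_eq_zero {g : ℕ → ℝ} {a b : ℕ} (hab : a ≤ b)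
    (h : ∀ i, a ≤ i → i < b → g i = 0) :
    ∑ i ∈ Finset.range b, g i = ∑ i ∈ Finset.range a, g i := by
  symm
  refine Finset.sum_subset (by simpa using hab) fun i hi hi' => h i ?_ (Finset.mem_range.1 hi)
  simpa using hi'

theorem cut_sum_cost_le (h2 : M.ImpactImmediate) (h : α.Feasible t q ω) (hθ : 0 ≤ q.θ)
    (hc : α.IsFirstAfter u ω c) (hcm : c ≤ m) {n : ℕ} (hn : n ≤ c) :
    ∑ i ∈ Finset.range n, (α.cut hf t q u m).cost t q i ω =
      ∑ i ∈ Finset.range n, α.cost t q i ω := by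
  refine Finset.sum_congr rfl fun i hi => ?_
  have hi := (Finset.mem_range.1 hi).trans_le hn
  exact (cut_trade_of_le h2 h hθ (hi.le.trans hcm) (hc.le i hi)).2.1

/-- What is dropped are free sales, so the cut strategy holds at least as many shares, for the same
cash. -/
theorem cut_sum_zeta_le (h2 : M.ImpactImmediate) (h : α.Feasible t q ω) (hθ : 0 ≤ q.θ)
    (hc : α.IsFirstAfter u ω c) (hcm : c ≤ m) {n : ℕ} (hn : n ≤ c) :
    ∑ i ∈ Finset.range n, α.ζ i ω ≤ ∑ i ∈ Finset.range n, (α.cut hf t q u m).ζ i ω := by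
  refine Finset.sum_le_sum fun i hi => ?_
  have hi := (Finset.mem_range.1 hi).trans_le hn
  exact (cut_trade_of_le h2 h hθ (hi.le.trans hcm) (hc.le i hi)).1

theorem cut_shares_le (h2 : M.ImpactImmediate) (h : α.Feasible t q ω) (hq : q ∈ M.stateSpace)
    (hc : α.IsFirstAfter u ω c) (hcm : c ≤ m) {n : ℕ} (hn : n ≤ c) :
    0 ≤ q.y + ∑ i ∈ Finset.range n, (α.cut hf t q u m).ζ i ω := by
  have h1 := cut_sum_zeta_le (hf := hf) h2 h hq.2.2.1 hc hcm hn
  cases n with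
  | zero => simpa using hq.1
  | succ n =>
    have := h.shares_nonneg (tau_le_iff.1 (hc.le n hn)).1
    linarith

theorem cut_lag_first_mem (h : α.Feasible t q ω) (htu : t ≤ u) (hc : α.IsFirstAfter u ω c)
    (hcm : c ≤ m) : (α.cut hf t q u m).lag t q c ω ∈ Icc 0 M.T := by
  rw [cut_lag_first hc hcm]
  cases c with
  -- Before any trade the lag at `u` is the fourth coordinate of the state, which feasibility places
  -- in `[0, T]`.
  | zero => exact ((mem_closedSolvency_iff _ _).1 (h.2.2 u htu hc.lt)).1.2.2
  | succ c =>
    have h1 := (tau_le_iff.1 (hc.le c c.lt_succ_self)).2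
    have h2 := (α.time_mem c ω).1
    simp only [prevTime]
    exact ⟨by linarith, by linarith [u.2.2]⟩

/-- The revenue of the sale made at time `u`. -/
theorem cut_cost_first (hc : α.IsFirstAfter u ω c) (hcm : c ≤ m)
    (hg : 0 < (α.cut hf t q u m).lag t q c ω) :
    (α.cut hf t q u m).cost t q c ω = -(M.price t q.p u ω *
      M.proceeds (M.bestSale m (q.y + ∑ i ∈ Finset.range c, (α.cut hf t q u m).ζ i ω)
        ((α.cut hf t q u m).lag t q c ω) m) ((α.cut hf t q u m).lag t q c ω)) := by
  rw [cost, cut_zeta_first hc hcm, if_pos hg, tradePrice_of_eq (cut_tau_of_gt hcm hc.lt), proceeds]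
  ring

theorem cut_zeta_first_mem (h2 : M.ImpactImmediate) (h : α.Feasible t q ω)
    (hq : q ∈ M.stateSpace) (hc : α.IsFirstAfter u ω c) (hcm : c ≤ m) :
    (α.cut hf t q u m).ζ c ω ≤ 0 ∧
      0 ≤ q.y + ∑ i ∈ Finset.range (c + 1), (α.cut hf t q u m).ζ i ω := by
  have h1 := cut_shares_le (hf := hf) h2 h hq hc hcm le_rfl
  rw [Finset.sum_range_succ, cut_zeta_first hc hcm]
  split_ifs
  · have := bestSale_mem (M := M) (le_refl m) h1 ((α.cut hf t q u m).lag t q c ω)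
    exact ⟨by linarith [this.1], by linarith [this.2]⟩
  · exact ⟨le_rfl, by linarith⟩

theorem cut_cost_first_nonpos (hp : 0 < q.p) (h2 : M.ImpactImmediate) (h : α.Feasible t q ω)
    (hq : q ∈ M.stateSpace) (hc : α.IsFirstAfter u ω c) (hcm : c ≤ m) :
    (α.cut hf t q u m).cost t q c ω ≤ 0 := by
  rw [cost, tradePrice_of_eq (cut_tau_of_gt hcm hc.lt)]
  exact mul_nonpos_of_nonpos_of_nonneg (mul_nonpos_of_nonpos_of_nonneg
    (cut_zeta_first_mem h2 h hq hc hcm).1 (price_pos hp ω).le) ENNReal.toReal_nonneg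

/-- Optimality on the grid turns each grid sale into a lower bound. It is used with the sale of
everything (`k = m`) and with a grid approximation of a sale made by `α` at the final time. -/
theorem cut_cash_first_ge (h2 : M.ImpactImmediate) (h : α.Feasible t q ω)
    (hq : q ∈ M.stateSpace) (hc : α.IsFirstAfter u ω c) (hcm : c ≤ m)
    (hg : 0 < (α.cut hf t q u m).lag t q c ω) {k : ℕ} (hk : k ≤ m) :
    q.x - ∑ i ∈ Finset.range c, α.cost t q i ω + M.price t q.p u ω *
        M.proceeds ((k : ℝ) / m * (q.y + ∑ i ∈ Finset.range c, (α.cut hf t q u m).ζ i ω))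
          ((α.cut hf t q u m).lag t q c ω) ≤
      q.x - ∑ i ∈ Finset.range (c + 1), (α.cut hf t q u m).cost t q i ω := by
  rw [Finset.sum_range_succ, cut_sum_cost_le h2 h hq.2.2.1 hc hcm le_rfl,
    cut_cost_first hc hcm hg]
  have := mul_le_mul_of_nonneg_left (proceeds_le_bestSale (M := M) (m := m) hk
    (q.y + ∑ i ∈ Finset.range c, (α.cut hf t q u m).ζ i ω)
    ((α.cut hf t q u m).lag t q c ω)) (price_pos (t := t) (s := u) hq.2.1 ω).le
  linarith

/-- After a trade the cash is already nonnegative and a sale can only add to it. Before any trade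
the cash may be negative, but the grid contains the sale of everything, which yields the liquidation
value at `u`; here `t < u` makes the lag positive. -/
theorem cut_cash_first_nonneg (h2 : M.ImpactImmediate) (h : α.Feasible t q ω)
    (hq : q ∈ M.stateSpace) (htu : t < u) (hm : 0 < m) (hc : α.IsFirstAfter u ω c)
    (hcm : c ≤ m) :
    0 ≤ q.x - ∑ i ∈ Finset.range (c + 1), (α.cut hf t q u m).cost t q i ω := by
  cases c with
  | zero =>
    have htu' : (t : ℝ) < u := htu
    have hl := cut_lag_first (hf := hf) (t := t) (q := q) hc hcm
    simp only [prevTime] at hl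
    have hg : 0 < (α.cut hf t q u m).lag t q 0 ω := by
      rw [hl]
      linarith [hq.2.2.1]
    refine le_trans ?_ (cut_cash_first_ge h2 h hq hc hcm hg le_rfl)
    have hL := ((mem_closedSolvency_iff _ _).1 (h.2.2 u htu.le hc.lt)).2
    have hm' : (m : ℝ) ≠ 0 := by positivity
    rw [hl]
    simp only [L] at hL
    simp only [Finset.range_zero, Finset.sum_empty, sub_zero, add_zero, div_self hm', one_mul,
      proceeds]
    linarith
  | succ c =>
    rw [Finset.sum_range_succ, cut_sum_cost_le h2 h hq.2.2.1 hc hcm le_rfl]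
    have h1 := h.cash_nonneg h2 (tau_le_iff.1 (hc.le c c.lt_succ_self)).1
    have h3 := cut_cost_first_nonpos (hf := hf) hq.2.1 h2 h hq hc hcm
    linarith

theorem cut_sum_cost_between (hc : α.IsFirstAfter u ω c) {n : ℕ} (hcn : c < n)
    (hn : n ≤ m + 1) : ∑ i ∈ Finset.range n, (α.cut hf t q u m).cost t q i ω =
      ∑ i ∈ Finset.range (c + 1), (α.cut hf t q u m).cost t q i ω :=
  sum_range_eq_of_eq_zero hcn fun _ h1 h2 =>
    cost_eq_zero_of_zeta_eq_zero (cut_zeta_between hc h1 (by omega))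

theorem cut_sum_zeta_between (hc : α.IsFirstAfter u ω c) {n : ℕ} (hcn : c < n)
    (hn : n ≤ m + 1) : ∑ i ∈ Finset.range n, (α.cut hf t q u m).ζ i ω =
      ∑ i ∈ Finset.range (c + 1), (α.cut hf t q u m).ζ i ω :=
  sum_range_eq_of_eq_zero hcn fun _ h1 h2 => cut_zeta_between hc h1 (by omega)

theorem cut_sum_zeta_last :
    q.y + ∑ i ∈ Finset.range (m + 2), (α.cut hf t q u m).ζ i ω = 0 := by
  rw [Finset.sum_range_succ, cut_zeta_last]
  ring

theorem cut_zeta_last_nonpos (h2 : M.ImpactImmediate) (h : α.Feasible t q ω)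
    (hq : q ∈ M.stateSpace) (hc : α.IsFirstAfter u ω c) (hcm : c ≤ m) :
    (α.cut hf t q u m).ζ (m + 1) ω ≤ 0 := by
  rw [cut_zeta_last, cut_sum_zeta_between hc (Nat.lt_succ_of_le hcm) le_rfl]
  exact neg_nonpos.2 (cut_zeta_first_mem h2 h hq hc hcm).2

theorem cut_cash_last_ge (h2 : M.ImpactImmediate) (h : α.Feasible t q ω)
    (hq : q ∈ M.stateSpace) (hc : α.IsFirstAfter u ω c) (hcm : c ≤ m) :
    q.x - ∑ i ∈ Finset.range (c + 1), (α.cut hf t q u m).cost t q i ω ≤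
      q.x - ∑ i ∈ Finset.range (m + 2), (α.cut hf t q u m).cost t q i ω := by
  rw [Finset.sum_range_succ _ (m + 1), cut_sum_cost_between hc (Nat.lt_succ_of_le hcm) le_rfl]
  have : (α.cut hf t q u m).cost t q (m + 1) ω ≤ 0 := by
    rw [cost, tradePrice_of_eq cut_tau_last]
    exact mul_nonpos_of_nonpos_of_nonneg (mul_nonpos_of_nonpos_of_nonneg
      (cut_zeta_last_nonpos h2 h hq hc hcm) (price_pos hq.2.1 ω).le) ENNReal.toReal_nonneg
  linarith

/-- This is the condition under which `compress` changes nothing. The sale at the final time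
satisfies it because `u < T` gives it a positive lag. -/
theorem cut_zeta_eq_zero_of_lag_eq_zero (huT : (u : ℝ) < M.T) (hm : α.τ m ω = ⊤) {n : ℕ}
    (hn : (α.cut hf t q u m).τ n ω ≠ ⊤) (hl : (α.cut hf t q u m).lag t q n ω = 0) :
    (α.cut hf t q u m).ζ n ω = 0 := by
  obtain ⟨c, hcm, hc⟩ := exists_isFirstAfter hm u
  have hn := cut_tau_ne_top_iff.1 hn
  rcases lt_trichotomy n c with h1 | rfl | h1
  · rw [cut_lag_of_le (h1.le.trans hcm) (hc.le n h1)] at hl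
    rw [cut_zeta_of_le (h1.le.trans hcm) (hc.le n h1), hl]
    simp
  · rw [cut_zeta_first hc hcm, hl]
    simp
  · rcases hn.eq_or_lt with rfl | hn
    · rw [cut_lag_last hc hcm] at hl
      linarith
    · exact cut_zeta_between hc h1 (by omega)

theorem Feasible.cut (h2 : M.ImpactImmediate) (h : α.Feasible t q ω)
    (hq : q ∈ M.stateSpace) (htu : t < u) (hm : 0 < m) (hmt : α.τ m ω = ⊤) :
    (α.cut hf t q u m).Feasible t q ω := by
  obtain ⟨c, hcm, hc⟩ := exists_isFirstAfter hmt u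
  have htu' : (t : WithTop (Icc (0 : ℝ) M.T)) ≤ u := WithTop.coe_le_coe.2 htu.le
  refine ⟨fun n => ?_, fun n hn => ?_, fun s hs hlt => h.2.2 s hs (hlt.trans_le ?_)⟩
  · by_cases hn : n ≤ m
    · by_cases hu : α.τ n ω ≤ u
      · rw [cut_tau_of_le hn hu]
        exact h.1 n
      · rw [cut_tau_of_gt hn (not_le.1 hu)]
        exact htu'
    · refine le_trans ?_ ((α.cut hf t q u m).mono ω (not_le.1 hn))
      change _ ≤ (α.cut hf t q u m).τ (m + 1) ω
      rw [cut_tau_last]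
      exact WithTop.coe_le_coe.2 (le_terminal t)
  · have hn' := cut_tau_ne_top_iff.1 hn
    have hfirst := cut_zeta_first_mem (hf := hf) h2 h hq hc hcm
    have hcash := cut_cash_first_nonneg (hf := hf) h2 h hq htu hm hc hcm
    rcases lt_or_ge n c with h1 | h1
    · have hnt := (tau_le_iff.1 (hc.le n h1)).1
      refine ⟨?_, stateAfter_mem hq.2.1 hn ?_ (cut_shares_le h2 h hq hc hcm h1)⟩
      · rw [cut_lag_of_le (h1.le.trans hcm) (hc.le n h1)]
        exact (cut_trade_of_le h2 h hq.2.2.1 (h1.le.trans hcm) (hc.le n h1)).2.2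
      · rw [cut_sum_cost_le h2 h hq.2.2.1 hc hcm h1]
        exact h.cash_nonneg h2 hnt
    -- Index `m + 1` is the sale at the final time; the remaining indices, from `c` to `m`, sit at
    -- `u`.
    · rcases hn'.eq_or_lt with rfl | hn'
      · refine ⟨?_, stateAfter_mem hq.2.1 hn ?_ cut_sum_zeta_last.ge⟩
        · refine impact_ne_top hf (cut_zeta_last_nonpos h2 h hq hc hcm) ?_
          rw [cut_lag_last hc hcm]
          exact ⟨by linarith [u.2.2], by linarith [u.2.1]⟩
        · exact hcash.trans (cut_cash_last_ge h2 h hq hc hcm)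
      · refine ⟨?_, stateAfter_mem hq.2.1 hn ?_ ?_⟩
        · rcases h1.eq_or_lt with rfl | h1
          · exact impact_ne_top hf hfirst.1 (cut_lag_first_mem h htu.le hc hcm)
          · rw [cut_zeta_between hc h1 (by omega), cut_lag_between hc h1 (by omega)]
            exact impact_ne_top hf le_rfl (left_mem_Icc.2 M.T_pos.le)
        · rwa [cut_sum_cost_between hc (by omega) (by omega)]
        · rw [cut_sum_zeta_between hc (by omega) (by omega)]
          exact hfirst.2
  · by_cases hu : α.τ 0 ω ≤ u
    · rw [cut_tau_of_le (Nat.zero_le m) hu]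
    · rw [cut_tau_of_gt (Nat.zero_le m) (not_le.1 hu)]
      exact (not_le.1 hu).le

theorem cut_state_terminal_x : ((α.cut hf t q u m).state t q M.terminal ω).x =
    q.x - ∑ i ∈ Finset.range (m + 2), (α.cut hf t q u m).cost t q i ω := by
  simp only [state]
  rw [tsum_terminal_eq (N := m + 2) cut_tau_eq_top]
  congr 1
  refine Finset.sum_congr rfl fun i hi => if_pos (cut_tau_ne_top_iff.2 ?_)
  exact Nat.lt_succ_iff.1 (Finset.mem_range.1 hi)

theorem cut_state_terminal_y : ((α.cut hf t q u m).state t q M.terminal ω).y = 0 := by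
  simp only [state]
  rw [tsum_terminal_eq (N := m + 2) cut_tau_eq_top]
  refine Eq.trans (congrArg (q.y + ·) ?_)
    (cut_sum_zeta_last (hf := hf) (α := α) (t := t) (u := u) (m := m) (ω := ω))
  refine Finset.sum_congr rfl fun i hi => if_pos (cut_tau_ne_top_iff.2 ?_)
  exact Nat.lt_succ_iff.1 (Finset.mem_range.1 hi)

end Cut

end Strategy

end Market
end IlliquidMarket

/-! ### Summability of the cash flows -/

namespace IlliquidMarket

/-- Cash flows of trades with a bid-ask spread at converging mid-prices are summable if neither the
cash nor the number of shares ever becomes negative. -/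
theorem summable_cost_of_spread {a φ π : ℕ → ℝ} {x y P κ : ℝ} (hP : 0 < P)
    (hπ : Tendsto π atTop (𝓝 P)) (hκ : 0 < κ)
    (hbid : ∀ n, 1 ≤ n → a n < 0 → φ n ≤ 1 - κ) (hask : ∀ n, 1 ≤ n → 0 < a n → 1 + κ ≤ φ n)
    (hX : ∀ n, 0 ≤ x - ∑ k ∈ Finset.range (n + 1), a k * π k * φ k)
    (hY : ∀ n, 0 ≤ y + ∑ k ∈ Finset.range (n + 1), a k) :
    Summable fun n => a n * π n * φ n := by
  -- Once `π n` is close to `P`, half of the spread `κ` survives around the limit price `P`.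
  have e1 : ∀ᶠ n in atTop, (1 - κ) * π n < (1 - κ / 2) * P :=
    (hπ.const_mul (1 - κ)).eventually_lt_const (by nlinarith)
  have e2 : ∀ᶠ n in atTop, (1 + κ / 2) * P < (1 + κ) * π n :=
    (hπ.const_mul (1 + κ)).eventually_const_lt (by nlinarith)
  have e3 : ∀ᶠ n in atTop, 0 < π n := hπ.eventually_const_lt hP
  obtain ⟨n₀, hn₀⟩ := eventually_atTop.1 (((e1.and e2).and e3).and (eventually_ge_atTop 1))
  have h1 : 1 ≤ n₀ := (hn₀ n₀ le_rfl).2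
  -- The loss of a trade relative to valuing its shares at `P`; the spread makes it at least a
  -- multiple of `|a n|`.
  set d : ℕ → ℝ := fun n => a n * π n * φ n - a n * P with hd
  have hdge : ∀ n, n₀ ≤ n → κ / 2 * P * |a n| ≤ d n := by
    intro n hn
    obtain ⟨⟨⟨h1, h2⟩, h3⟩, h4⟩ := hn₀ n hn
    simp only [hd]
    rcases lt_trichotomy (a n) 0 with h | h | h
    · rw [abs_of_neg h]
      have h5 : π n * φ n ≤ (1 - κ / 2) * P := by
        have := mul_le_mul_of_nonneg_left (hbid n h4 h) h3.le
        linarith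
      have := mul_le_mul_of_nonneg_left h5 (neg_pos.2 h).le
      linarith
    · simp [h]
    · rw [abs_of_pos h]
      have h5 : (1 + κ / 2) * P ≤ π n * φ n := by
        have := mul_le_mul_of_nonneg_left (hask n h4 h) h3.le
        linarith
      have := mul_le_mul_of_nonneg_left h5 h.le
      linarith
  have hc : 0 < κ / 2 * P := by positivity
  have hds : Summable fun n => d (n + n₀) := by
    refine summable_of_sum_range_le (c := x + P * y - ∑ i ∈ Finset.range n₀, d i)
      (fun n => (by positivity : 0 ≤ κ / 2 * P * |a (n + n₀)|).trans (hdge _ (by omega)))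
      fun n => ?_
    have hsum : ∑ i ∈ Finset.range n, d (i + n₀) =
        ∑ i ∈ Finset.range (n + n₀), d i - ∑ i ∈ Finset.range n₀, d i := by
      rw [add_comm n n₀, Finset.sum_range_add]
      simp [add_comm]
    -- Marked to the price `P`, the portfolio starts at `x + P * y` and never becomes negative, so
    -- the losses have bounded partial sums.
    have hle : ∑ i ∈ Finset.range (n + n₀), d i ≤ x + P * y := by
      obtain ⟨k, hk⟩ : ∃ k, n + n₀ = k + 1 := ⟨n + n₀ - 1, by omega⟩
      rw [hk]
      simp only [hd, Finset.sum_sub_distrib, ← Finset.sum_mul]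
      have := mul_nonneg hP.le (hY k)
      linarith [hX k]
    linarith
  have has : Summable fun n => a (n + n₀) := by
    refine Summable.of_norm_bounded (hds.mul_left (κ / 2 * P)⁻¹) fun n => ?_
    rw [Real.norm_eq_abs, ← div_eq_inv_mul, le_div_iff₀ hc]
    linarith [hdge (n + n₀) (by omega)]
  rw [← summable_nat_add_iff n₀]
  refine (hds.add (has.mul_right P)).congr fun n => ?_
  simp only [hd]
  ring

namespace Market

variable {Ω : Type*} [mΩ : MeasurableSpace Ω] {M : Market Ω}

/-- The finiteness condition on purchases is needed because `toReal` sends `∞` to `0`. -/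
theorem exists_spread (h : M.ImpactSpread) : ∃ κ : ℝ, 0 < κ ∧
    (∀ e < 0, ∀ θ ∈ Icc 0 M.T, (M.f e θ).toReal ≤ 1 - κ) ∧
    ∀ e > 0, ∀ θ ∈ Icc 0 M.T, M.f e θ ≠ ∞ → 1 + κ ≤ (M.f e θ).toReal := by
  set s := ⨆ e ∈ Iio (0 : ℝ), ⨆ θ ∈ Icc 0 M.T, M.f e θ with hs
  -- The infimum over purchases may be `∞`; capping it at `2` gives a finite real margin.
  set i := min (⨅ e ∈ Ioi (0 : ℝ), ⨅ θ ∈ Icc 0 M.T, M.f e θ) 2 with hi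
  have hs1 : s.toReal < 1 := by
    have := (ENNReal.toReal_lt_toReal (h.bid.trans ENNReal.one_lt_top).ne ENNReal.one_ne_top).2
      h.bid
    rwa [ENNReal.toReal_one] at this
  have hi0 : i ≠ ∞ := ((min_le_right _ _).trans_lt (by simp : (2 : ℝ≥0∞) < ∞)).ne
  have hi1 : 1 < i.toReal := by
    have h1 : 1 < i := lt_min h.ask (by norm_num)
    have := (ENNReal.toReal_lt_toReal ENNReal.one_ne_top hi0).2 h1
    rwa [ENNReal.toReal_one] at this
  refine ⟨min (1 - s.toReal) (i.toReal - 1), lt_min (by linarith) (by linarith), ?_, ?_⟩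
  · intro e he θ hθ
    have h1 : M.f e θ ≤ s :=
      (le_iSup₂ (f := fun θ (_ : θ ∈ Icc 0 M.T) => M.f e θ) θ hθ).trans
        (le_iSup₂ (f := fun e (_ : e ∈ Iio (0 : ℝ)) => ⨆ θ ∈ Icc 0 M.T, M.f e θ) e he)
    have h2 := ENNReal.toReal_mono (h.bid.trans ENNReal.one_lt_top).ne h1
    have := min_le_left (1 - s.toReal) (i.toReal - 1)
    linarith
  · intro e he θ hθ hfin
    have h1 : i ≤ M.f e θ := (min_le_left _ _).trans
      ((iInf₂_le (f := fun e (_ : e ∈ Ioi (0 : ℝ)) => ⨅ θ ∈ Icc 0 M.T, M.f e θ) e he).trans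
        (iInf₂_le (f := fun θ (_ : θ ∈ Icc 0 M.T) => M.f e θ) θ hθ))
    have h2 := ENNReal.toReal_mono hfin h1
    have := min_le_right (1 - s.toReal) (i.toReal - 1)
    linarith

theorem continuous_price {t : Icc (0 : ℝ) M.T} {p : ℝ} {ω : Ω}
    (h : Continuous fun s => M.W s ω) : Continuous fun s => M.price t p s ω := by
  unfold price
  fun_prop

namespace Strategy

variable {α : M.Strategy} {t : Icc (0 : ℝ) M.T} {q : State} {ω : Ω}

/-- Infinitely many trades accumulate at a time where the price converges. -/
theorem exists_tendsto_tradePrice (hp : 0 < q.p) (hW : Continuous fun s => M.W s ω)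
    (hτ : ∀ n, α.τ n ω ≠ ⊤) :
    ∃ P, 0 < P ∧ Tendsto (fun n => α.tradePrice t q n ω) atTop (𝓝 P) := by
  choose s hs using fun n => WithTop.ne_top_iff_exists.1 (hτ n)
  have hmono : Monotone fun n => (s n : ℝ) := fun i j hij => by
    have := α.mono ω hij
    simp only [← hs, WithTop.coe_le_coe] at this
    exact this
  have hbdd : BddAbove (range fun n => (s n : ℝ)) := ⟨M.T, by rintro _ ⟨n, rfl⟩; exact (s n).2.2⟩
  have hlim := tendsto_atTop_ciSup hmono hbdd
  have hmem : (⨆ n, (s n : ℝ)) ∈ Icc 0 M.T :=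
    isClosed_Icc.mem_of_tendsto hlim (Eventually.of_forall fun n => (s n).2)
  have hlim' : Tendsto s atTop (𝓝 ⟨_, hmem⟩) := tendsto_subtype_rng.2 hlim
  refine ⟨_, price_pos (t := t) hp ω, (((continuous_price hW).tendsto _).comp hlim').congr fun n => ?_⟩
  exact (tradePrice_of_eq (hs n).symm).symm

/-- The first trade is left out: its lag counts from `t - θ`, which may be negative, so the bound by
`T` needs another argument. -/
theorem Feasible.lag_mem (h : α.Feasible t q ω) (hθ : 0 ≤ q.θ) {n : ℕ} (hn : 1 ≤ n)
    (hτ : α.τ n ω ≠ ⊤) : α.lag t q n ω ∈ Icc 0 M.T := by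
  refine ⟨h.lag_nonneg hθ hτ, ?_⟩
  obtain ⟨k, rfl⟩ : ∃ k, n = k + 1 := ⟨n - 1, by omega⟩
  simp only [lag]
  linarith [(α.time_mem (k + 1) ω).2, (α.time_mem k ω).1]

/-- The cash is defined by a `tsum`, whose value is `0` without summability; only summability makes
the terminal cash a limit of the cash after finitely many trades. -/
theorem Feasible.summable_cost (h2 : M.ImpactImmediate) (h3 : M.ImpactSpread)
    (h : α.Feasible t q ω) (hq : q ∈ M.stateSpace) (hW : Continuous fun s => M.W s ω) :
    Summable fun n => if α.τ n ω ≤ M.terminal then α.cost t q n ω else 0 := by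
  by_cases hτ : ∀ n, α.τ n ω ≠ ⊤
  · simp only [tau_le_terminal_iff, hτ, not_false_eq_true, ne_eq, if_true]
    obtain ⟨κ, hκ, hbid, hask⟩ := exists_spread h3
    obtain ⟨P, hP, hlim⟩ := exists_tendsto_tradePrice (t := t) (q := q) hq.2.1 hW hτ
    exact summable_cost_of_spread (x := q.x) (y := q.y) hP hlim hκ
      (fun n hn ha => hbid _ ha _ (h.lag_mem hq.2.2.1 hn (hτ n)))
      (fun n hn ha => hask _ ha _ (h.lag_mem hq.2.2.1 hn (hτ n)) (h.2.1 n (hτ n)).1)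
      (fun n => h.cash_nonneg h2 (hτ n)) (fun n => h.shares_nonneg (hτ n))
  · push Not at hτ
    obtain ⟨N, hN⟩ := hτ
    refine summable_of_ne_finset_zero (s := Finset.range N) fun n hn => if_neg fun hle => ?_
    exact (tau_le_iff.1 hle).1 (tau_eq_top_of_le (by simpa using hn) hN)

end Strategy

end Market
end IlliquidMarket

/-! ### Asymptotic comparison of the final cash -/

namespace IlliquidMarket
namespace Market

variable {Ω : Type*} [mΩ : MeasurableSpace Ω] {M : Market Ω}

namespace Strategy

variable {α : M.Strategy} {t : Icc (0 : ℝ) M.T} {q : State} {ω : Ω} {hf : M.ImpactMonotone}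

/-- The final cash when the first `m` trades of `α` are cut at time `u`. -/
noncomputable def cutCash (hf : M.ImpactMonotone) (α : M.Strategy) (t : Icc (0 : ℝ) M.T)
    (q : State) (u : Icc (0 : ℝ) M.T) (m : ℕ) (ω : Ω) : ℝ :=
  (((α.truncate m).cut hf t q u m).state t q M.terminal ω).x

/-- The sales added at `u` and at the final time never reduce the cash. -/
theorem cutCash_ge (h2 : M.ImpactImmediate) (h : α.Feasible t q ω) (hq : q ∈ M.stateSpace)
    {u : Icc (0 : ℝ) M.T} {m c : ℕ} (hm : 0 < m) (hcm : c ≤ m)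
    (hc : (α.truncate m).IsFirstAfter u ω c) :
    q.x - ∑ i ∈ Finset.range c, α.cost t q i ω ≤ cutCash hf α t q u m ω := by
  have h' := h.truncate hm
  rw [cutCash, cut_state_terminal_x]
  refine le_trans ?_ (cut_cash_last_ge h2 h' hq hc hcm)
  rw [Finset.sum_range_succ, cut_sum_cost_le h2 h' hq.2.2.1 hc hcm le_rfl]
  have h3 := cut_cost_first_nonpos (hf := hf) hq.2.1 h2 h' hq hc hcm
  have h4 : ∑ i ∈ Finset.range c, (α.truncate m).cost t q i ω =
      ∑ i ∈ Finset.range c, α.cost t q i ω :=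
    Finset.sum_congr rfl fun i hi => truncate_cost ((Finset.mem_range.1 hi).trans_le hcm)
  linarith

/-- If no trade later than the preceding one takes place at the final time, cutting `α` shortly
before the final time is asymptotically not worse. -/
theorem exists_le_cutCash_of_not_late (h2 : M.ImpactImmediate) (h3 : M.ImpactSpread)
    (h : α.Feasible t q ω) (hq : q ∈ M.stateSpace) (hW : Continuous fun s => M.W s ω)
    {u : ℕ → Icc (0 : ℝ) M.T} (hu : Tendsto (fun n => (u n : ℝ)) atTop (𝓝 M.T))
    (hJ : ∀ n, α.τ n ω = M.terminal → ¬ 0 < α.lag t q n ω) :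
    ∃ ℓ : ℕ → ℝ, Tendsto ℓ atTop (𝓝 (α.state t q M.terminal ω).x) ∧
      ∀ᶠ m in atTop, ℓ m ≤ cutCash hf α t q (u m) m ω := by
  classical
  -- The witness is the cash of `α` when only those of its first `m` trades made by time `u m` are
  -- counted.
  refine ⟨fun m => q.x - ∑' n, if n < m ∧ α.τ n ω ≤ u m then α.cost t q n ω else 0, ?_, ?_⟩
  · simp only [state]
    refine Tendsto.const_sub _ (tendsto_tsum_of_dominated_convergence
      (h.summable_cost h2 h3 hq hW).norm (fun n => ?_) (Eventually.of_forall fun m n => ?_))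
    · by_cases htop : α.τ n ω = ⊤
      · simp [htop]
      obtain ⟨s, hs⟩ := WithTop.ne_top_iff_exists.1 htop
      rw [if_pos (tau_le_terminal_iff.2 htop)]
      simp only [← hs, WithTop.coe_le_coe]
      rcases (le_terminal s).eq_or_lt with hsT | hsT
      · have h0 : α.lag t q n ω = 0 :=
          le_antisymm (not_lt.1 (hJ n (by rw [← hs, hsT]))) (h.lag_nonneg hq.2.2.1 htop)
        rw [(cost_eq_zero_of_lag_eq_zero h2 (h.2.1 n htop).1 h0).2]
        simp
      · have hsT' : (s : ℝ) < M.T := hsT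
        refine tendsto_const_nhds.congr' ?_
        filter_upwards [eventually_gt_atTop n, hu.eventually_const_lt hsT'] with m hm hum
        exact (if_pos ⟨hm, (show (s : ℝ) ≤ u m from hum.le)⟩).symm
    · by_cases hn : n < m ∧ α.τ n ω ≤ u m
      · rw [if_pos hn, if_pos (tau_le_terminal_iff.2 (tau_le_iff.1 hn.2).1)]
      · rw [if_neg hn, norm_zero]
        exact norm_nonneg _
  · filter_upwards [eventually_gt_atTop 0] with m hm
    obtain ⟨c, hcm, hc⟩ := exists_isFirstAfter (truncate_tau_eq_top (α := α) (ω := ω) (le_refl m))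
      (u m)
    refine le_trans (le_of_eq ?_) (cutCash_ge h2 h hq hm hcm hc)
    congr 1
    rw [tsum_eq_sum (s := Finset.range c)]
    · refine Finset.sum_congr rfl fun i hi => ?_
      have hi := Finset.mem_range.1 hi
      have := hc.le i hi
      rw [truncate_tau (hi.trans_le hcm)] at this
      exact if_pos ⟨hi.trans_le hcm, this⟩
    · intro i hi
      refine if_neg fun hi' => not_le.2 (hc.tau_gt (by simpa using hi)) ?_
      rw [truncate_tau hi'.1]
      exact hi'.2

theorem prevTime_lt_of_late {n : ℕ} (hn : α.τ n ω = M.terminal) (hl : 0 < α.lag t q n ω) :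
    α.prevTime t q n ω < M.T := by
  rw [lag_eq, time_of_eq hn] at hl
  exact sub_pos.1 hl

/-- For a first trade at the final time, feasibility bounds the lag at every earlier `s`; let `s`
tend to `T`. The bound puts the lag in the domain where `f` is continuous. -/
theorem Feasible.lag_le_of_lt (h : α.Feasible t q ω) (ht : (t : ℝ) < M.T) {n : ℕ}
    (hn : α.τ n ω = M.terminal) (hθ : 0 ≤ q.θ) : α.lag t q n ω ≤ M.T := by
  cases n with
  | succ n => exact (h.lag_mem hθ (by omega) (by simp [hn])).2
  | zero =>
    refine le_of_forall_lt_imp_le_of_dense fun a ha => ?_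
    simp only [lag, time_of_eq hn] at ha
    by_contra! haT
    have haT' : M.T < a := haT
    have hT : ((M.terminal : Icc (0 : ℝ) M.T) : ℝ) = M.T := rfl
    rw [hT] at ha
    obtain ⟨s, hs1, hs2⟩ : ∃ s, max (t : ℝ) (a + (t - q.θ)) < s ∧ s < M.T :=
      exists_between (max_lt ht (by linarith))
    have hs3 := (le_max_left _ _).trans_lt hs1
    have hs4 := (le_max_right _ _).trans_lt hs1
    have := ((mem_closedSolvency_iff _ _).1 (h.2.2 ⟨s, t.2.1.trans hs3.le, hs2.le⟩ hs3.le
      (by rw [hn]; exact WithTop.coe_lt_coe.2 hs2))).1.2.2.2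
    simp only at this
    linarith

/-- If a trade later than the preceding one takes place at the final time, cutting `α` shortly
before is asymptotically not worse. -/
theorem exists_le_cutCash_of_late (h2 : M.ImpactImmediate) (hcf : M.ImpactContinuous)
    (h : α.Feasible t q ω) (hq : q ∈ M.stateSpace) (hW : Continuous fun s => M.W s ω)
    (ht : (t : ℝ) < M.T) {u : ℕ → Icc (0 : ℝ) M.T} (huT : ∀ n, (u n : ℝ) < M.T)
    (hu : Tendsto (fun n => (u n : ℝ)) atTop (𝓝 M.T)) {J : ℕ} (hJ : α.τ J ω = M.terminal)
    (hl : 0 < α.lag t q J ω) :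
    ∃ ℓ : ℕ → ℝ, Tendsto ℓ atTop (𝓝 (α.state t q M.terminal ω).x) ∧
      ∀ᶠ m in atTop, ℓ m ≤ cutCash hf α t q (u m) m ω := by
  classical
  have hJtop : α.τ J ω ≠ ⊤ := by simp [hJ]
  have hprev := prevTime_lt_of_late hJ hl
  have hlagJ : α.lag t q J ω = M.T - α.prevTime t q J ω := by rw [lag_eq, time_of_eq hJ]; rfl
  -- Every trade after `J` is at the final time with zero lag, hence free: the cash is a finite sum,
  -- with no need of summability.
  have hX : (α.state t q M.terminal ω).x =
      q.x - ∑ i ∈ Finset.range J, α.cost t q i ω - α.cost t q J ω := by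
    simp only [state]
    rw [sub_sub, ← Finset.sum_range_succ, tsum_eq_sum (s := Finset.range (J + 1))]
    · congr 1
      refine Finset.sum_congr rfl fun i hi => if_pos (tau_le_terminal_iff.2 ?_)
      exact tau_ne_top_of_le (Nat.lt_succ_iff.1 (Finset.mem_range.1 hi)) hJtop
    · intro i hi
      have hi : J + 1 ≤ i := by simpa using hi
      by_cases htop : α.τ i ω = ⊤
      · simp [htop]
      obtain ⟨k, rfl⟩ : ∃ k, i = k + 1 := ⟨i - 1, by omega⟩
      have h1 := time_mono (by omega : J ≤ k) (tau_ne_top_of_le k.le_succ htop)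
      rw [time_of_eq hJ] at h1
      have h0 : α.lag t q (k + 1) ω = 0 := by
        refine le_antisymm ?_ (h.lag_nonneg hq.2.2.1 htop)
        have h5 : ((M.terminal : Icc (0 : ℝ) M.T) : ℝ) = M.T := rfl
        simp only [lag]
        linarith [(α.time_mem (k + 1) ω).2]
      rw [(cost_eq_zero_of_lag_eq_zero h2 (h.2.1 _ htop).1 h0).2]
      simp
  have hfirst : ∀ m, J < m → α.prevTime t q J ω < u m →
      (α.truncate m).IsFirstAfter (u m) ω J := by
    intro m hm hum
    refine ⟨?_, fun i hi => ?_⟩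
    · rw [truncate_tau hm, hJ]
      exact WithTop.coe_lt_coe.2 (huT m)
    · rw [truncate_tau (hi.trans hm)]
      obtain ⟨k, rfl⟩ : ∃ k, J = k + 1 := ⟨J - 1, by omega⟩
      have hk := tau_ne_top_of_le k.le_succ hJtop
      refine tau_le_iff.2 ⟨tau_ne_top_of_le hi.le hJtop, ?_⟩
      exact (time_mono (Nat.lt_succ_iff.1 hi) hk).trans hum.le
  have hev : ∀ᶠ m in atTop, J < m ∧ α.prevTime t q J ω < u m :=
    (eventually_gt_atTop J).and (hu.eventually_const_lt hprev)
  -- A purchase at the final time only costs cash, so leaving it out is enough; the rest of the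
  -- proof imitates a sale.
  rcases le_or_gt 0 (α.ζ J ω) with hζ | hζ
  · refine ⟨fun _ => (α.state t q M.terminal ω).x, tendsto_const_nhds, ?_⟩
    filter_upwards [hev] with m ⟨hm, hum⟩
    refine le_trans ?_ (cutCash_ge h2 h hq (by omega) hm.le (hfirst m hm hum))
    have : 0 ≤ α.cost t q J ω :=
      mul_nonneg (mul_nonneg hζ (tradePrice_pos hq.2.1 hJtop).le) ENNReal.toReal_nonneg
    linarith
  set e := -α.ζ J ω with he
  have he0 : 0 < e := neg_pos.2 hζ
  -- The holdings of the cut strategy just before its sale at `u m`, which do not depend on `m` once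
  -- `m` is large.
  set A := q.y + ∑ i ∈ Finset.range J, if 0 < α.lag t q i ω then α.ζ i ω else 0 with hA
  have hAm : ∀ m, J < m → α.prevTime t q J ω < u m →
      q.y + ∑ i ∈ Finset.range J, ((α.truncate m).cut hf t q (u m) m).ζ i ω = A := by
    intro m hm hum
    rw [hA]
    congr 1
    refine Finset.sum_congr rfl fun i hi => ?_
    have hi := Finset.mem_range.1 hi
    rw [cut_zeta_of_le (hi.trans hm).le ((hfirst m hm hum).le i hi), truncate_lag (hi.trans hm)]
    rfl
  have heA : e ≤ A := by
    obtain ⟨m, hm, hum⟩ := hev.exists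
    rw [← hAm m hm hum]
    have h1 := cut_sum_zeta_le (hf := hf) h2 (h.truncate (m := m) (by omega)) hq.2.2.1
      (hfirst m hm hum) hm.le le_rfl
    have h3 := h.shares_nonneg hJtop
    rw [Finset.sum_range_succ] at h3
    have h4 : ∑ i ∈ Finset.range J, (α.truncate m).ζ i ω = ∑ i ∈ Finset.range J, α.ζ i ω := rfl
    linarith
  have hA0 : 0 < A := he0.trans_le heA
  -- The largest grid point not exceeding `e`: rounding down keeps the sale within the grid, and the
  -- error vanishes as the mesh `A / m` does.
  have hlim_sale : Tendsto (fun m : ℕ => (⌊e / A * (m : ℝ)⌋₊ : ℝ) / m * A) atTop (𝓝 e) := by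
    have := ((tendsto_nat_floor_mul_div_atTop (R := ℝ) (a := e / A) (by positivity)).comp
      tendsto_natCast_atTop_atTop).mul_const A
    rwa [div_mul_cancel₀ _ hA0.ne'] at this
  have hlim_price : Tendsto (fun m => M.price t q.p (u m) ω) atTop
      (𝓝 (M.price t q.p M.terminal ω)) :=
    ((continuous_price hW).tendsto _).comp (tendsto_subtype_rng.2 hu)
  have hlagT := h.lag_le_of_lt ht hJ hq.2.2.1
  have hgap : ∀ᶠ m in atTop, (u m : ℝ) - α.prevTime t q J ω ∈ Ioc 0 M.T := by
    filter_upwards [hev] with m ⟨hm, hum⟩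
    exact ⟨sub_pos.2 hum, by linarith [huT m]⟩
  have hlim_impact : Tendsto (fun m => (M.f (-e) (u m - α.prevTime t q J ω)).toReal) atTop
      (𝓝 (M.f (-e) (α.lag t q J ω)).toReal) := by
    refine (ENNReal.tendsto_toReal (impact_ne_top hf (by linarith) ⟨hl.le, hlagT⟩)).comp ?_
    have hcw := hcf (-e, α.lag t q J ω) ⟨by simpa using he0.ne', hl, hlagT⟩
    refine Tendsto.comp (f := fun m => ((-e, (u m : ℝ) - α.prevTime t q J ω) : ℝ × ℝ)) hcw ?_
    refine tendsto_nhdsWithin_iff.2 ⟨?_, ?_⟩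
    · rw [hlagJ]
      exact tendsto_const_nhds.prodMk_nhds (hu.sub_const _)
    · filter_upwards [hgap] with m hm
      exact ⟨by simpa using he0.ne', hm⟩
  refine ⟨fun m => q.x - ∑ i ∈ Finset.range J, α.cost t q i ω + M.price t q.p (u m) ω *
    ((⌊e / A * (m : ℝ)⌋₊ : ℝ) / m * A * (M.f (-e) (u m - α.prevTime t q J ω)).toReal), ?_, ?_⟩
  · have := (hlim_price.mul (hlim_sale.mul hlim_impact)).const_add
      (q.x - ∑ i ∈ Finset.range J, α.cost t q i ω)
    convert this using 2
    rw [hX, cost, tradePrice_of_eq hJ, he, neg_neg]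
    ring
  · filter_upwards [hev, hgap] with m ⟨hm, hum⟩ hg
    have hm0 : 0 < m := by omega
    have hc := hfirst m hm hum
    have hlag := cut_lag_first (hf := hf) (t := t) (q := q) hc hm.le
    have hprevm : (α.truncate m).prevTime t q J ω = α.prevTime t q J ω := by
      cases J with
      | zero => rfl
      | succ J => exact truncate_time (by omega)
    rw [hprevm] at hlag
    have hk : ⌊e / A * (m : ℝ)⌋₊ ≤ m := by
      refine Nat.floor_le_of_le ?_
      exact mul_le_of_le_one_left (by positivity) (div_le_one_of_le₀ heA hA0.le)
    have hge := cut_cash_first_ge (hf := hf) h2 (h.truncate hm0) hq hc hm.le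
      (by rw [hlag]; exact hg.1) hk
    rw [hAm m hm hum, hlag] at hge
    rw [cutCash, cut_state_terminal_x]
    refine le_trans ?_ (cut_cash_last_ge h2 (h.truncate hm0) hq hc hm.le)
    refine le_trans ?_ hge
    have h4 : ∑ i ∈ Finset.range J, (α.truncate m).cost t q i ω =
        ∑ i ∈ Finset.range J, α.cost t q i ω :=
      Finset.sum_congr rfl fun i hi => truncate_cost ((Finset.mem_range.1 hi).trans hm)
    rw [h4]
    gcongr
    · exact (price_pos hq.2.1 ω).le
    rw [proceeds]
    have hr0 : 0 ≤ (⌊e / A * (m : ℝ)⌋₊ : ℝ) / m * A := by positivity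
    -- A smaller sale gets a better unit price, so the grid sale is at least as well paid per share
    -- as a sale of `e`. Thus `f` only has to be continuous along the fixed amount `-e`.
    refine mul_le_mul_of_nonneg_left (ENNReal.toReal_mono
      (impact_ne_top hf (by linarith) ⟨hg.1.le, hg.2⟩) (hf.mono _ ⟨hg.1.le, hg.2⟩ ?_)) hr0
    have hfl : (⌊e / A * (m : ℝ)⌋₊ : ℝ) ≤ e / A * m := Nat.floor_le (by positivity)
    have : (⌊e / A * (m : ℝ)⌋₊ : ℝ) / m * A ≤ e := by
      have hm' : (0 : ℝ) < m := by exact_mod_cast hm0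
      calc _ ≤ e / A * m / m * A := by gcongr
        _ = e := by field_simp
    linarith

theorem exists_le_cutCash (h2 : M.ImpactImmediate) (h3 : M.ImpactSpread)
    (hcf : M.ImpactContinuous) (h : α.Feasible t q ω) (hq : q ∈ M.stateSpace)
    (hW : Continuous fun s => M.W s ω) (ht : (t : ℝ) < M.T) {u : ℕ → Icc (0 : ℝ) M.T}
    (huT : ∀ n, (u n : ℝ) < M.T)
    (hu : Tendsto (fun n => (u n : ℝ)) atTop (𝓝 M.T)) :
    ∃ ℓ : ℕ → ℝ, Tendsto ℓ atTop (𝓝 (α.state t q M.terminal ω).x) ∧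
      ∀ᶠ m in atTop, ℓ m ≤ cutCash hf α t q (u m) m ω := by
  by_cases hJ : ∃ n, α.τ n ω = M.terminal ∧ 0 < α.lag t q n ω
  · obtain ⟨J, hJ, hl⟩ := hJ
    exact exists_le_cutCash_of_late h2 hcf h hq hW ht huT hu hJ hl
  · push Not at hJ
    exact exists_le_cutCash_of_not_late h2 h3 h hq hW hu fun n hn => not_lt.2 (hJ n hn)

end Strategy

end Market
end IlliquidMarket

/-! ### Expectations, Fatou's lemma and the penalty -/

namespace IlliquidMarket

section Expectation

variable {Ω : Type*} [MeasurableSpace Ω] {μ : Measure Ω}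

theorem expectation_mono_ae {ξ η : Ω → EReal} (h : ∀ᵐ ω ∂μ, ξ ω ≤ η ω) :
    expectation μ ξ ≤ expectation μ η := by
  refine EReal.sub_le_sub ?_ ?_
  · refine EReal.coe_ennreal_le_coe_ennreal_iff.2 (lintegral_mono_ae ?_)
    filter_upwards [h] with ω hω
    exact EReal.toENNReal_le_toENNReal hω
  · refine EReal.coe_ennreal_le_coe_ennreal_iff.2 (lintegral_mono_ae ?_)
    filter_upwards [h] with ω hω
    exact EReal.toENNReal_le_toENNReal (EReal.neg_le_neg_iff.2 hω)

theorem expectation_coe_of_nonneg {ξ : Ω → ℝ} (h : ∀ᵐ ω ∂μ, 0 ≤ ξ ω) :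
    expectation μ (fun ω => (ξ ω : EReal)) = ((∫⁻ ω, ENNReal.ofReal (ξ ω) ∂μ : ℝ≥0∞) : EReal) := by
  have h0 : ∫⁻ ω, (-(ξ ω : EReal)).toENNReal ∂μ = 0 := by
    rw [← lintegral_zero (μ := μ)]
    refine lintegral_congr_ae ?_
    filter_upwards [h] with ω hω
    refine EReal.toENNReal_of_nonpos ?_
    rw [← EReal.coe_neg]
    exact_mod_cast neg_nonpos.2 hω
  rw [expectation, h0]
  simp

/-- A bounded cost per scenario changes the expectation by an arbitrarily small amount when it is
scaled down. -/
theorem exists_lt_expectation_sub [IsProbabilityMeasure μ] {ξ : Ω → ℝ} {n : Ω → ℝ≥0∞} {N : ℕ}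
    (hn : ∀ᵐ ω ∂μ, n ω ≤ N) {a : EReal}
    (ha : a < ((∫⁻ ω, ENNReal.ofReal (ξ ω) ∂μ : ℝ≥0∞) : EReal)) (hξ : ∀ᵐ ω ∂μ, 0 ≤ ξ ω) :
    ∃ ε : ℝ, 0 < ε ∧
      a < expectation μ fun ω => (ξ ω : EReal) - (ε : EReal) * ((n ω : ℝ≥0∞) : EReal) := by
  obtain ⟨r', har', hr'⟩ := EReal.lt_iff_exists_real_btwn.1 ha
  obtain ⟨r, hrr, hr⟩ := EReal.lt_iff_exists_real_btwn.1 hr'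
  have hrr' : r' < r := by exact_mod_cast hrr
  have hN : (0 : ℝ) < N + 1 := by positivity
  -- The gap `r - r'` is split in two halves: the penalty lowers the integral of the positive part
  -- by at most one half, and the negative part has integral at most the other.
  set ε : ℝ := (r - r') / (2 * (N + 1)) with hε
  have hε0 : 0 < ε := div_pos (by linarith) (by positivity)
  have hεN : ε * N ≤ (r - r') / 2 := by
    have : ε * (N + 1) = (r - r') / 2 := by
      rw [hε]
      field_simp
    nlinarith
  set c := (r - r') / 2 with hc
  have hc0 : 0 ≤ c := by rw [hc]; linarith
  refine ⟨ε, hε0, har'.trans ?_⟩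
  have hcoe : ∀ᵐ ω ∂μ, ∃ k : ℝ, 0 ≤ k ∧ k ≤ c ∧
      (ξ ω : EReal) - (ε : EReal) * ((n ω : ℝ≥0∞) : EReal) = ((ξ ω - k : ℝ) : EReal) := by
    filter_upwards [hn] with ω hω
    have hfin : n ω ≠ ∞ := (hω.trans_lt (ENNReal.natCast_lt_top N)).ne
    have hle : (n ω).toReal ≤ N := by
      have := ENNReal.toReal_mono (ENNReal.natCast_ne_top N) hω
      simpa using this
    refine ⟨ε * (n ω).toReal, by positivity, ?_, ?_⟩
    · exact (mul_le_mul_of_nonneg_left hle hε0.le).trans hεN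
    · rw [EReal.coe_sub, EReal.coe_mul, EReal.coe_ennreal_toReal hfin]
  have h1 : ∫⁻ ω, ENNReal.ofReal (ξ ω) ∂μ ≤
      ∫⁻ ω, ((ξ ω : EReal) - (ε : EReal) * ((n ω : ℝ≥0∞) : EReal)).toENNReal ∂μ +
        ENNReal.ofReal c := by
    have : ENNReal.ofReal c = ∫⁻ _, ENNReal.ofReal c ∂μ := by simp
    rw [this, ← lintegral_add_right _ measurable_const]
    refine lintegral_mono_ae ?_
    filter_upwards [hcoe] with ω ⟨k, hk0, hkc, hk⟩
    rw [hk, EReal.real_coe_toENNReal]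
    exact (ENNReal.ofReal_le_ofReal (by linarith)).trans (ENNReal.ofReal_add_le (p := ξ ω - k))
  have h2 : ∫⁻ ω, (-((ξ ω : EReal) - (ε : EReal) * ((n ω : ℝ≥0∞) : EReal))).toENNReal ∂μ ≤
      ENNReal.ofReal c := by
    have : ENNReal.ofReal c = ∫⁻ _, ENNReal.ofReal c ∂μ := by simp
    rw [this]
    refine lintegral_mono_ae ?_
    filter_upwards [hcoe, hξ] with ω ⟨k, hk0, hkc, hk⟩ h0
    rw [hk, ← EReal.coe_neg, EReal.real_coe_toENNReal]
    exact ENNReal.ofReal_le_ofReal (by linarith)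
  unfold expectation
  generalize (∫⁻ ω, ENNReal.ofReal (ξ ω) ∂μ) = I at *
  generalize (∫⁻ ω, ((ξ ω : EReal) - (ε : EReal) * ((n ω : ℝ≥0∞) : EReal)).toENNReal ∂μ) = J at *
  generalize (∫⁻ ω, (-((ξ ω : EReal) - (ε : EReal) * ((n ω : ℝ≥0∞) : EReal))).toENNReal ∂μ) = K
    at *
  have hK : K ≠ ∞ := (h2.trans_lt ENNReal.ofReal_lt_top).ne
  lift K to ℝ≥0 using hK
  rcases eq_or_ne J ∞ with rfl | hJ
  · have : ((∞ : ℝ≥0∞) : EReal) - (((K : ℝ≥0) : ℝ≥0∞) : EReal) = ⊤ := rfl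
    rw [this]
    exact EReal.coe_lt_top r'
  lift J to ℝ≥0 using hJ
  have h3 : (K : ℝ) ≤ c := by
    have := ENNReal.toReal_mono ENNReal.ofReal_ne_top h2
    rwa [ENNReal.toReal_ofReal hc0] at this
  have h4 : r < J + c := by
    have h5 : (r : EReal) < (((J : ℝ≥0∞) + ENNReal.ofReal c : ℝ≥0∞) : EReal) :=
      hr.trans_le (EReal.coe_ennreal_le_coe_ennreal_iff.2 h1)
    rw [EReal.coe_ennreal_add, EReal.coe_ennreal_ofReal, max_eq_left hc0,
      show (((J : ℝ≥0) : ℝ≥0∞) : EReal) = ((J : ℝ) : EReal) from rfl] at h5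
    exact_mod_cast h5
  have h5 : (((J : ℝ≥0) : ℝ≥0∞) : EReal) - (((K : ℝ≥0) : ℝ≥0∞) : EReal) =
      (((J : ℝ) - (K : ℝ) : ℝ) : EReal) := rfl
  rw [h5]
  exact_mod_cast (by rw [hc] at h3 h4; linarith : r' < J - K)

end Expectation

namespace Market

variable {Ω : Type*} [mΩ : MeasurableSpace Ω] {M : Market Ω} {μ : Measure Ω}

theorem UtilityCondition.nonneg (hU : M.UtilityCondition) {x : ℝ} (hx : 0 ≤ x) : 0 ≤ M.U x := by
  obtain ⟨K, γ, -, -, -, h⟩ := hU.growth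
  exact (h x hx).1

theorem UtilityCondition.measurable (hU : M.UtilityCondition) :
    Measurable fun x => M.U (max x 0) :=
  Monotone.measurable fun _ _ h =>
    hU.mono (mem_Ici.2 (le_max_right _ _)) (mem_Ici.2 (le_max_right _ _)) (max_le_max_right _ h)

/-- Lower semicontinuity of the utility function along sequences. -/
theorem UtilityCondition.le_liminf (hU : M.UtilityCondition) {x : ℝ} {ℓ z : ℕ → ℝ} (hx : 0 ≤ x)
    (hℓ : Tendsto ℓ atTop (𝓝 x)) (hz : ∀ m, 0 ≤ z m) (hle : ∀ᶠ m in atTop, ℓ m ≤ z m) :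
    ENNReal.ofReal (M.U x) ≤ liminf (fun m => ENNReal.ofReal (M.U (z m))) atTop := by
  -- The concave function `U` may jump at `0`, but there `U 0 = 0` is a trivial lower bound; at
  -- interior points concavity gives continuity.
  rcases hx.eq_or_lt with rfl | hx
  · simp [hU.zero]
  have hcont : ContinuousAt M.U x := by
    have := hU.concave.continuousOn_interior
    rw [interior_Ici] at this
    exact this.continuousAt (Ioi_mem_nhds hx)
  have hlim : Tendsto (fun m => ENNReal.ofReal (M.U (max (ℓ m) 0))) atTop
      (𝓝 (ENNReal.ofReal (M.U x))) := by
    refine ENNReal.tendsto_ofReal (hcont.tendsto.comp ?_)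
    have := hℓ.max (tendsto_const_nhds (x := (0 : ℝ)))
    rwa [max_eq_left hx.le] at this
  rw [← hlim.liminf_eq]
  refine liminf_le_liminf ?_
  filter_upwards [hle] with m hm
  exact ENNReal.ofReal_le_ofReal (hU.mono (mem_Ici.2 (le_max_right _ _)) (hz m) (max_le hm (hz m)))

namespace Strategy

variable {α : M.Strategy} {t : Icc (0 : ℝ) M.T} {q : State}

/-- Paths are continuous only almost surely. Setting `W` to zero off a measurable set of full
measure makes it jointly measurable, so that it can be evaluated at the random time. -/
theorem aemeasurable_tradePrice (hW : IsBrownianMotion M.𝓕 M.W μ) (α : M.Strategy)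
    (t : Icc (0 : ℝ) M.T) (q : State) (n : ℕ) : AEMeasurable (α.tradePrice t q n) μ := by
  obtain ⟨G, hG, hGm, hGc⟩ := hW.continuous_paths.exists_measurable_mem
  have hWm : ∀ s, Measurable (M.W s) := fun s => (hW.adapted s).mono (M.𝓕.le s) le_rfl
  have hV : Measurable (Function.uncurry fun s => G.indicator (M.W s)) := by
    refine measurable_uncurry_of_continuous_of_measurable (fun ω => ?_)
      fun s => (hWm s).indicator hGm
    by_cases hω : ω ∈ G
    · simpa [hω] using hGc ω hω
    · simpa [hω] using continuous_const
  have hτ : Measurable fun ω => (α.τ n ω).untopD t := by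
    have : Measurable (α.τ n) := (α.isStoppingTime n).measurable.mono
      ((α.isStoppingTime n).measurableSpace_le) le_rfl
    exact this.untopD t
  have htop : MeasurableSet {ω | α.τ n ω = ⊤} := by
    have : Measurable (α.τ n) := (α.isStoppingTime n).measurable.mono
      ((α.isStoppingTime n).measurableSpace_le) le_rfl
    exact this (measurableSet_singleton ⊤)
  have hVτ : Measurable fun ω => G.indicator (M.W ((α.τ n ω).untopD t)) ω :=
    hV.comp (hτ.prodMk measurable_id)
  classical
  refine ⟨fun ω => if α.τ n ω = ⊤ then 0 else q.p * Real.exp ((M.b - M.σ ^ 2 / 2) *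
    ((((α.τ n ω).untopD t : Icc (0 : ℝ) M.T) : ℝ) - t) +
      M.σ * (G.indicator (M.W ((α.τ n ω).untopD t)) ω - M.W t ω)), ?_, ?_⟩
  · refine Measurable.ite htop measurable_const (Measurable.const_mul (Real.measurable_exp.comp
      (Measurable.add (Measurable.const_mul ?_ _) ((hVτ.sub (hWm t)).const_mul _))) _)
    exact (measurable_subtype_coe.comp hτ).sub_const _
  · filter_upwards [hG] with ω hω
    by_cases h : α.τ n ω = ⊤
    · simp [h, tradePrice]
    · obtain ⟨s, hs⟩ := WithTop.ne_top_iff_exists.1 h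
      rw [if_neg h, tradePrice_of_eq hs.symm, ← hs]
      simp [price, hω]

theorem aemeasurable_cost (hW : IsBrownianMotion M.𝓕 M.W μ) (hf : M.ImpactMonotone)
    (α : M.Strategy) (t : Icc (0 : ℝ) M.T) (q : State) (n : ℕ) :
    AEMeasurable (α.cost t q n) μ := by
  have hle := (α.isStoppingTime n).measurableSpace_le
  have hζ : Measurable (α.ζ n) := (α.measurable_ζ n).mono hle le_rfl
  have hlag : Measurable (α.lag t q n) := (α.measurable_lag t q n).mono hle le_rfl
  exact (hζ.aemeasurable.mul (aemeasurable_tradePrice hW α t q n)).mul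
    (hf.measurable.comp (hζ.prodMk hlag)).ennreal_toReal.aemeasurable

theorem aemeasurable_cutCash (hW : IsBrownianMotion M.𝓕 M.W μ) (hf : M.ImpactMonotone)
    (α : M.Strategy) (t : Icc (0 : ℝ) M.T) (q : State) (u : Icc (0 : ℝ) M.T) (m : ℕ) :
    AEMeasurable (cutCash hf α t q u m) μ := by
  have : cutCash hf α t q u m = fun ω => q.x - ∑ i ∈ Finset.range (m + 2),
      ((α.truncate m).cut hf t q u m).cost t q i ω := funext fun ω => cut_state_terminal_x
  rw [this]
  exact (Finset.aemeasurable_fun_sum _ fun i _ => aemeasurable_cost hW hf _ t q i).const_sub _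

theorem Liquidating.cash_nonneg (h : α.Liquidating μ t q) :
    ∀ᵐ ω ∂μ, 0 ≤ (α.state t q M.terminal ω).x := by
  filter_upwards [h.1, h.2] with ω h1 h2
  have := ((mem_closedSolvency_iff _ _).1 (h1.2.2 M.terminal (le_terminal t))).2
  rwa [L_eq_cash_of_no_shares h2] at this

theorem Liquidating.expectation_eq (hU : M.UtilityCondition) (h : α.Liquidating μ t q) :
    expectation μ (fun ω => ((M.U (α.state t q M.terminal ω).x : ℝ) : EReal)) =
      ((∫⁻ ω, ENNReal.ofReal (M.U (α.state t q M.terminal ω).x) ∂μ : ℝ≥0∞) : EReal) := by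
  refine expectation_coe_of_nonneg ?_
  filter_upwards [h.cash_nonneg] with ω hω
  exact hU.nonneg hω

/-- The strategy obtained from the first `m` trades of `α` by liquidating from time `u` on and
dropping the trades made at the time of the preceding one. -/
noncomputable def approx (hf : M.ImpactMonotone) (α : M.Strategy) (t : Icc (0 : ℝ) M.T)
    (q : State) (u : Icc (0 : ℝ) M.T) (m : ℕ) : M.Strategy :=
  ((α.truncate m).cut hf t q u m).compress t q (m + 2)

theorem approx_spec (hf : M.ImpactMonotone) (h2 : M.ImpactImmediate) (h : α.Admissible μ t q)
    (hq : q ∈ M.stateSpace) {u : Icc (0 : ℝ) M.T} (htu : t < u) (huT : (u : ℝ) < M.T) {m : ℕ}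
    (hm : 0 < m) :
    (α.approx hf t q u m).FiniteLiquidating μ t q ∧
      (∀ᵐ ω ∂μ, ((α.approx hf t q u m).state t q M.terminal ω).x = cutCash hf α t q u m ω) ∧
      ∀ ω, (α.approx hf t q u m).numTrades ω ≤ (m + 2 : ℕ) := by
  have hfeas : ∀ᵐ ω ∂μ, ((α.truncate m).cut hf t q u m).Feasible t q ω := by
    filter_upwards [h.feasible] with ω hω
    exact (hω.truncate hm).cut h2 hq htu hm (truncate_tau_eq_top le_rfl)
  have hzero : ∀ ω, ∀ n, ((α.truncate m).cut hf t q u m).τ n ω ≠ ⊤ →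
      ((α.truncate m).cut hf t q u m).lag t q n ω = 0 →
      ((α.truncate m).cut hf t q u m).ζ n ω = 0 := fun ω n hn hl =>
    cut_zeta_eq_zero_of_lag_eq_zero huT (truncate_tau_eq_top le_rfl) hn hl
  refine ⟨compress_finiteLiquidating hq.2.2.1 ⟨?_, ?_⟩ (fun ω => cut_tau_eq_top)
    (Eventually.of_forall hzero), ?_, fun ω => numTrades_le (compress_tau_eq_top _ _ _ _ _)⟩
  · exact admissible_of_feasible h2 hq.2.1 hq.2.2.1 (fun ω => cut_tau_eq_top) hfeas
  · exact Eventually.of_forall fun ω => cut_state_terminal_y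
  · filter_upwards [hfeas] with ω hω
    rw [approx, compress_state hω hq.2.2.1 cut_tau_eq_top (hzero ω), cutCash]

/-- A liquidating strategy is approximated by strategies with a bounded number of trades, if there
is time left. -/
theorem exists_finiteLiquidating_of_lt (hW : IsBrownianMotion M.𝓕 M.W μ) (hf : M.ImpactMonotone)
    (h2 : M.ImpactImmediate) (h3 : M.ImpactSpread) (hcf : M.ImpactContinuous)
    (hU : M.UtilityCondition) (h : α.Liquidating μ t q) (hq : q ∈ M.stateSpace)
    (ht : (t : ℝ) < M.T) {a : EReal}
    (ha : a < ((∫⁻ ω, ENNReal.ofReal (M.U (α.state t q M.terminal ω).x) ∂μ : ℝ≥0∞) : EReal)) :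
    ∃ (β : M.Strategy) (N : ℕ), β.FiniteLiquidating μ t q ∧ (∀ ω, β.numTrades ω ≤ N) ∧
      a < ((∫⁻ ω, ENNReal.ofReal (M.U (β.state t q M.terminal ω).x) ∂μ : ℝ≥0∞) : EReal) := by
  obtain ⟨u', -, hu', hulim'⟩ := exists_seq_strictMono_tendsto' ht
  set u : ℕ → Icc (0 : ℝ) M.T := fun n => ⟨u' n, t.2.1.trans (hu' n).1.le, (hu' n).2.le⟩ with hu
  have huT : ∀ n, (u n : ℝ) < M.T := fun n => (hu' n).2
  have htu : ∀ n, t < u n := fun n => (hu' n).1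
  have hulim : Tendsto (fun n => (u n : ℝ)) atTop (𝓝 M.T) := hulim'
  -- The shift to `m + 1` ensures that the truncation keeps at least one index.
  have hspec := fun m : ℕ => approx_spec hf h2 h.1 hq (htu (m + 1)) (huT (m + 1)) m.succ_pos
  set X : ℕ → Ω → ℝ := fun m => cutCash hf α t q (u (m + 1)) (m + 1) with hX
  have hXnn : ∀ᵐ ω ∂μ, ∀ m, 0 ≤ X m ω := ae_all_iff.2 fun m => by
    filter_upwards [(hspec m).1.1.cash_nonneg, (hspec m).2.1] with ω h1 h2
    rwa [h2] at h1
  have hmeas : ∀ m, AEMeasurable (fun ω => ENNReal.ofReal (M.U (X m ω))) μ := fun m => by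
    refine ((hU.measurable.comp_aemeasurable (aemeasurable_cutCash hW hf α t q (u (m + 1))
      (m + 1))).congr ?_).ennreal_ofReal
    filter_upwards [hXnn] with ω hω
    change M.U (max (X m ω) 0) = M.U (X m ω)
    rw [max_eq_left (hω m)]
  -- Utilities of final cash are nonnegative, so Fatou's lemma applies without any domination; a
  -- lower bound in the limit is all that is needed.
  have hfatou : ∫⁻ ω, ENNReal.ofReal (M.U (α.state t q M.terminal ω).x) ∂μ ≤
      ⨆ m, ∫⁻ ω, ENNReal.ofReal (M.U (X m ω)) ∂μ := by
    calc _ ≤ ∫⁻ ω, liminf (fun m => ENNReal.ofReal (M.U (X m ω))) atTop ∂μ := by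
          refine lintegral_mono_ae ?_
          filter_upwards [h.1.feasible, h.cash_nonneg, hXnn, hW.continuous_paths]
            with ω h1 h4 h5 h6
          obtain ⟨ℓ, hℓ, hle⟩ := exists_le_cutCash (hf := hf) h2 h3 hcf h1 hq h6 ht huT hulim
          exact hU.le_liminf h4 (hℓ.comp (tendsto_add_atTop_nat 1)) h5
            ((tendsto_add_atTop_nat 1).eventually hle)
      _ ≤ liminf (fun m => ∫⁻ ω, ENNReal.ofReal (M.U (X m ω)) ∂μ) atTop :=
          lintegral_liminf_le' hmeas
      _ ≤ _ := liminf_le_of_le (by isBoundedDefault) fun b hb => by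
          obtain ⟨m, hm⟩ := hb.exists
          exact hm.trans (le_iSup (fun m => ∫⁻ ω, ENNReal.ofReal (M.U (X m ω)) ∂μ) m)
  obtain ⟨m, hm⟩ : ∃ m, a < ((∫⁻ ω, ENNReal.ofReal (M.U (X m ω)) ∂μ : ℝ≥0∞) : EReal) := by
    by_contra! hcon
    have ha0 : 0 ≤ a := (EReal.coe_ennreal_nonneg _).trans (hcon 0)
    refine not_le.2 ha ?_
    rw [← EReal.coe_toENNReal ha0]
    refine EReal.coe_ennreal_le_coe_ennreal_iff.2 (hfatou.trans (iSup_le fun m => ?_))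
    refine EReal.coe_ennreal_le_coe_ennreal_iff.1 ?_
    rw [EReal.coe_toENNReal ha0]
    exact hcon m
  refine ⟨_, _, (hspec m).1, (hspec m).2.2, hm.trans_eq ?_⟩
  congr 1
  refine lintegral_congr_ae ?_
  filter_upwards [(hspec m).2.1] with ω hω
  rw [hω]

end Strategy

end Market
end IlliquidMarket

/-! ### The final time and the conclusion -/

namespace IlliquidMarket
namespace Market

variable {Ω : Type*} [mΩ : MeasurableSpace Ω] {M : Market Ω} {μ : Measure Ω}

theorem price_self {t : Icc (0 : ℝ) M.T} {p : ℝ} {ω : Ω} : M.price t p t ω = p := by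
  simp [price]

namespace Strategy

variable {α : M.Strategy} {t : Icc (0 : ℝ) M.T} {q : State} {ω : Ω}

/-- Sell `y` shares at the final time, unless `y = 0`. -/
noncomputable def finalSale (M : Market Ω) (y : ℝ) : M.Strategy where
  τ n _ := if n = 0 ∧ y ≠ 0 then M.terminal else ⊤
  ζ _ _ := -y
  isStoppingTime n := by
    split_ifs
    · exact isStoppingTime_const _ _
    · intro i
      simp
  mono ω i n h := by
    dsimp only
    split_ifs with h1 h2
    · exact le_rfl
    · exact le_top
    · exact absurd ⟨by omega, ‹n = 0 ∧ y ≠ 0›.2⟩ h1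
    · exact le_rfl
  measurable_ζ n := measurable_const

theorem finalSale_tau_ne_top_iff {y : ℝ} {n : ℕ} :
    (finalSale M y).τ n ω ≠ ⊤ ↔ n = 0 ∧ y ≠ 0 := by
  simp only [finalSale]
  split_ifs with h <;> simp [h]

theorem finalSale_tau_zero {y : ℝ} (hy : y ≠ 0) : (finalSale M y).τ 0 ω = M.terminal :=
  if_pos ⟨rfl, hy⟩

theorem finalSale_tau_one {y : ℝ} : (finalSale M y).τ 1 ω = ⊤ := by
  simp [finalSale]

theorem finalSale_lag {y : ℝ} (hy : y ≠ 0) : (finalSale M y).lag M.terminal q 0 ω = q.θ := by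
  simp [lag, time_of_eq (finalSale_tau_zero hy)]

theorem finalSale_cost :
    (finalSale M q.y).cost M.terminal q 0 ω = -(q.y * q.p * (M.f (-q.y) q.θ).toReal) := by
  rcases eq_or_ne q.y 0 with hy | hy
  · simp [cost, finalSale, hy]
  · rw [cost, finalSale_lag hy, tradePrice_of_eq (finalSale_tau_zero hy), price_self]
    simp [finalSale]

theorem finalSale_state_x :
    ((finalSale M q.y).state M.terminal q M.terminal ω).x = M.L q := by
  simp only [state]
  rw [tsum_terminal_eq (N := 1) finalSale_tau_one, Finset.sum_range_one, finalSale_cost, L]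
  rcases eq_or_ne q.y 0 with hy | hy
  · simp [hy]
  · rw [if_pos (finalSale_tau_ne_top_iff.2 ⟨rfl, hy⟩)]
    ring

theorem finalSale_state_y :
    ((finalSale M q.y).state M.terminal q M.terminal ω).y = 0 := by
  simp only [state]
  rw [tsum_terminal_eq (N := 1) finalSale_tau_one, Finset.sum_range_one]
  rcases eq_or_ne q.y 0 with hy | hy
  · simp [finalSale, hy]
  · simp [finalSale, hy]

theorem finalSale_feasible (hf : M.ImpactMonotone) (hq : q ∈ M.closedSolvency)
    (ω : Ω) : (finalSale M q.y).Feasible M.terminal q ω := by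
  obtain ⟨hq1, hL⟩ := (mem_closedSolvency_iff _ _).1 hq
  refine ⟨fun n => ?_, fun n hn => ?_, fun s hs hlt => ?_⟩
  · simp only [finalSale]
    split_ifs
    · exact le_rfl
    · exact le_top
  · obtain ⟨rfl, hy⟩ := finalSale_tau_ne_top_iff.1 hn
    refine ⟨?_, stateAfter_mem hq1.2.1 hn ?_ ?_⟩
    · rw [finalSale_lag hy]
      exact impact_ne_top hf (neg_nonpos.2 hq1.1) hq1.2.2
    · rw [zero_add, Finset.sum_range_one, finalSale_cost]
      simpa [L] using hL
    · simp [finalSale]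
  · obtain rfl : s = M.terminal := le_antisymm (le_terminal s) hs
    simpa [price_self] using hq

theorem finalSale_finiteLiquidating (hf : M.ImpactMonotone) (h2 : M.ImpactImmediate)
    (hq : q ∈ M.closedSolvency) (h : q.y = 0 ∨ 0 < q.θ) :
    (finalSale M q.y).FiniteLiquidating μ M.terminal q := by
  obtain ⟨hq1, -⟩ := (mem_closedSolvency_iff _ _).1 hq
  refine ⟨⟨admissible_of_feasible h2 hq1.2.1 hq1.2.2.1 (fun ω => finalSale_tau_one)
    (Eventually.of_forall (finalSale_feasible hf hq)), ?_⟩, ?_⟩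
  · exact Eventually.of_forall fun ω => finalSale_state_y
  · refine Eventually.of_forall fun ω =>
      ⟨(numTrades_le finalSale_tau_one).trans_lt (by simp), fun n hn => ?_⟩
    obtain ⟨rfl, hy⟩ := finalSale_tau_ne_top_iff.1 hn
    rw [finalSale_lag hy]
    exact h.resolve_left hy

/-- At the final time, no strategy does better than an immediate sale of all the shares. -/
theorem Feasible.terminal_cash_le (h2 : M.ImpactImmediate) (h : α.Feasible M.terminal q ω)
    (hq : q ∈ M.stateSpace) (hL : ∀ r ∈ Icc 0 q.y, M.L { q with y := r } ≤ M.L q) :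
    (α.state M.terminal q M.terminal ω).x ≤ M.L q := by
  have hτ : ∀ n, α.τ n ω ≠ ⊤ → α.τ n ω = M.terminal := fun n hn =>
    le_antisymm (tau_le_terminal_iff.2 hn) (h.1 n)
  -- Selling nothing is the case `r = 0` of the condition on `L`.
  have hx : q.x ≤ M.L q := by
    have := hL 0 ⟨le_rfl, hq.1⟩
    rwa [L_eq_cash_of_no_shares rfl] at this
  simp only [state]
  -- All trades take place at `T`, so all but the first have zero lag and are free.
  rw [tsum_eq_single 0]
  · split_ifs with h0
    · have h0 := tau_le_terminal_iff.1 h0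
      have hlag : α.lag M.terminal q 0 ω = q.θ := by simp [lag, time_of_eq (hτ 0 h0)]
      have hsh := h.shares_nonneg h0
      rw [zero_add, Finset.sum_range_one] at hsh
      rw [cost, hlag, tradePrice_of_eq (hτ 0 h0), price_self]
      rcases le_or_gt 0 (α.ζ 0 ω) with hζ | hζ
      · have := mul_nonneg (mul_nonneg hζ hq.2.1.le)
          (ENNReal.toReal_nonneg (a := M.f (α.ζ 0 ω) q.θ))
        linarith
      -- Shares remain nonnegative after the first trade, so the amount sold is an admissible `r`.
      · have := hL (-α.ζ 0 ω) ⟨by linarith, by linarith⟩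
        simp only [L, neg_neg] at this ⊢
        linarith
    · simpa using hx
  · intro n hn
    by_cases htop : α.τ n ω = ⊤
    · simp [htop]
    obtain ⟨k, rfl⟩ := Nat.exists_eq_succ_of_ne_zero hn
    have hlag : α.lag M.terminal q (k + 1) ω = 0 := by
      simp [lag, time_of_eq (hτ _ htop), time_of_eq (hτ k (tau_ne_top_of_le k.le_succ htop))]
    rw [(cost_eq_zero_of_lag_eq_zero h2 (h.2.1 _ htop).1 hlag).2]
    simp

theorem exists_finiteLiquidating (hW : IsBrownianMotion M.𝓕 M.W μ) (hf : M.ImpactMonotone)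
    (h2 : M.ImpactImmediate) (h3 : M.ImpactSpread) (hcf : M.ImpactContinuous)
    (hU : M.UtilityCondition) (h : α.Liquidating μ t q) (hq : q ∈ M.closedSolvency)
    (ht : (t : ℝ) < M.T ∨
      ((q.y = 0 ∨ 0 < q.θ) ∧ ∀ r ∈ Icc 0 q.y, M.L { q with y := r } ≤ M.L q)) {a : EReal}
    (ha : a < ((∫⁻ ω, ENNReal.ofReal (M.U (α.state t q M.terminal ω).x) ∂μ : ℝ≥0∞) : EReal)) :
    ∃ (β : M.Strategy) (N : ℕ), β.FiniteLiquidating μ t q ∧ (∀ ω, β.numTrades ω ≤ N) ∧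
      a < ((∫⁻ ω, ENNReal.ofReal (M.U (β.state t q M.terminal ω).x) ∂μ : ℝ≥0∞) : EReal) := by
  obtain ⟨hq1, hL0⟩ := (mem_closedSolvency_iff _ _).1 hq
  by_cases htT : (t : ℝ) < M.T
  · exact exists_finiteLiquidating_of_lt hW hf h2 h3 hcf hU h hq1 htT ha
  obtain ⟨hθ, hL⟩ := ht.resolve_left htT
  obtain rfl : t = M.terminal := le_antisymm (le_terminal t) (not_lt.1 htT)
  refine ⟨finalSale M q.y, 1, finalSale_finiteLiquidating hf h2 hq hθ,
    fun ω => numTrades_le finalSale_tau_one, ha.trans_le ?_⟩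
  refine EReal.coe_ennreal_le_coe_ennreal_iff.2 (lintegral_mono_ae ?_)
  filter_upwards [h.1.feasible, h.cash_nonneg] with ω h4 h5
  rw [finalSale_state_x]
  exact ENNReal.ofReal_le_ofReal (hU.mono h5 hL0 (h4.terminal_cash_le h2 hq1 hL))

theorem Liquidating.liquidation_value_eq (h : α.Liquidating μ t q) :
    ∀ᵐ ω ∂μ, M.L (α.state t q M.terminal ω) = (α.state t q M.terminal ω).x := by
  filter_upwards [h.2] with ω hω
  exact L_eq_cash_of_no_shares hω

end Strategy

theorem le_value {α : M.Strategy} {t : Icc (0 : ℝ) M.T} {q : State} (h : α.Liquidating μ t q) :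
    expectation μ (fun ω => ((M.U (α.state t q M.terminal ω).x : ℝ) : EReal)) ≤
      M.value μ t q :=
  le_iSup₂_of_le α h le_rfl

theorem le_penalizedValue {α : M.Strategy} {t : Icc (0 : ℝ) M.T} {q : State}
    (h : α.FiniteLiquidating μ t q) (ε : ℝ) :
    expectation μ (fun ω => ((M.U (M.L (α.state t q M.terminal ω)) : ℝ) : EReal) -
        (ε : EReal) * ((α.numTrades ω : ℝ≥0∞) : EReal)) ≤ M.penalizedValue μ ε t q :=
  le_iSup₂_of_le α h le_rfl

theorem penalizedValue_antitoneOn (t : Icc (0 : ℝ) M.T) (q : State) :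
    AntitoneOn (fun ε : ℝ => M.penalizedValue μ ε t q) (Ioi 0) := by
  intro ε₁ _ ε₂ _ hε
  refine iSup₂_mono fun α _ => expectation_mono_ae (Eventually.of_forall fun ω => ?_)
  exact EReal.sub_le_sub le_rfl (mul_le_mul_of_nonneg_right (EReal.coe_le_coe_iff.2 hε)
    (EReal.coe_ennreal_nonneg _))

/-- The penalized problem has fewer strategies and, since no shares are left at the end, the same
reward minus a nonnegative penalty. -/
theorem penalizedValue_le_value {ε : ℝ} (hε : 0 ≤ ε) (t : Icc (0 : ℝ) M.T) (q : State) :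
    M.penalizedValue μ ε t q ≤ M.value μ t q := by
  refine iSup₂_le fun α hα => le_trans (expectation_mono_ae ?_) (le_value hα.1)
  filter_upwards [hα.1.liquidation_value_eq] with ω hω
  rw [hω]
  refine EReal.sub_le_of_le_add' (le_add_of_nonneg_left ?_)
  exact mul_nonneg (EReal.coe_nonneg.2 hε) (EReal.coe_ennreal_nonneg _)

theorem exists_lt_penalizedValue [IsProbabilityMeasure μ] (hW : IsBrownianMotion M.𝓕 M.W μ)
    (hf : M.ImpactMonotone) (h2 : M.ImpactImmediate) (h3 : M.ImpactSpread)
    (hcf : M.ImpactContinuous) (hU : M.UtilityCondition) {t : Icc (0 : ℝ) M.T} {q : State}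
    (hq : q ∈ M.closedSolvency) (ht : (t : ℝ) < M.T ∨
      ((q.y = 0 ∨ 0 < q.θ) ∧ ∀ r ∈ Icc 0 q.y, M.L { q with y := r } ≤ M.L q)) {a : EReal}
    (ha : a < M.value μ t q) : ∃ ε : ℝ, 0 < ε ∧ a < M.penalizedValue μ ε t q := by
  obtain ⟨α, hα⟩ := lt_iSup_iff.1 ha
  obtain ⟨hα, ha⟩ := lt_iSup_iff.1 hα
  rw [hα.expectation_eq hU] at ha
  obtain ⟨β, N, hβ, hN, ha⟩ := Strategy.exists_finiteLiquidating hW hf h2 h3 hcf hU hα hq ht ha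
  obtain ⟨ε, hε, ha⟩ := exists_lt_expectation_sub (Eventually.of_forall hN) ha (by
    filter_upwards [hβ.1.cash_nonneg] with ω hω
    exact hU.nonneg hω)
  refine ⟨ε, hε, ha.trans_le (le_trans (expectation_mono_ae ?_) (le_penalizedValue hβ ε))⟩
  filter_upwards [hβ.1.liquidation_value_eq] with ω hω
  rw [hω]

end Market
end IlliquidMarket

theorem proposition6p1 {Ω : Type*} [MeasurableSpace Ω] (μ : Measure Ω) [IsProbabilityMeasure μ]
    (M : IlliquidMarket.Market Ω)
    (hσ : 0 < M.σ)
    (h𝓕 : IlliquidMarket.UsualConditions M.𝓕 μ)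
    (hW : IlliquidMarket.IsBrownianMotion M.𝓕 M.W μ)
    (h1f : M.ImpactMonotone) (h2f : M.ImpactImmediate) (h3f : M.ImpactSpread)
    (hcf : M.ImpactContinuous) (hU : M.UtilityCondition) :
    (∀ (t : Icc (0 : ℝ) M.T) (q : IlliquidMarket.State), q ∈ M.closedSolvency →
      AntitoneOn (fun ε : ℝ => M.penalizedValue μ ε t q) (Ioi 0)) ∧
    (∀ (t : Icc (0 : ℝ) M.T) (q : IlliquidMarket.State), q ∈ M.closedSolvency →
      ((t : ℝ) < M.T ∨
        ((q.y = 0 ∨ 0 < q.θ) ∧ ∀ r ∈ Icc 0 q.y, M.L { q with y := r } ≤ M.L q)) →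
      Tendsto (fun ε : ℝ => M.penalizedValue μ ε t q) (𝓝[>] 0) (𝓝 (M.value μ t q))) := by
  have hanti := fun t q => IlliquidMarket.Market.penalizedValue_antitoneOn (M := M) (μ := μ) t q
  refine ⟨fun t q _ => hanti t q, fun t q hq ht => tendsto_order.2 ⟨fun a ha => ?_, fun a ha => ?_⟩⟩
  · obtain ⟨ε₀, hε₀, hlt⟩ :=
      IlliquidMarket.Market.exists_lt_penalizedValue hW h1f h2f h3f hcf hU hq ht ha
    -- By monotonicity, one good `ε₀` gives the bound for every smaller positive `ε`.
    filter_upwards [Ioc_mem_nhdsGT hε₀] with ε hε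
    exact hlt.trans_le (hanti t q hε.1 hε₀ hε.2)
  · filter_upwards [self_mem_nhdsWithin] with ε hε
    exact (IlliquidMarket.Market.penalizedValue_le_value (le_of_lt hε) t q).trans_lt ha
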